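/- Let $L$ be a positive-definite even lattice, that is, a free abelian group of finite rank with a positive-definite symmetric $\mathbb Z$-bilinear form $(\cdot,\cdot)$ such that $(\alpha,\alpha)\in 2\mathbb Z$ for all $\alpha\in L$. Put $\mathfrak h=\mathbb C\otimes_{\mathbb Z}L$, let $M(1)=\mathbb C[h(-n)\mid h\in\mathfrak h,\ n>0]$ be the Heisenberg vertex operator algebra of $\mathfrak h$, with conformal vector $\frac12\sum_i u_i(-1)^2\mathbf 1$ for an orthonormal basis $(u_i)$ of $\mathfrak h$, and let $V_L=M(1)\otimes\mathbb C[L]$ be the lattice vertex operator algebra, constructed from any normalized 2-cocycle $\varepsilon:L\times L\to\{\pm1\}$ with $\varepsilon(\alpha,\beta)\varepsilon(\beta,\alpha)^{-1}=(-1)^{(\alpha,\beta)}$; it contains $M(1)=M(1)\otimes e^0$. Let $(V,Y,\mathbf 1,\omega)$ be a simple vertex operator algebra over $\mathbb C$ which has a vertex operator subalgebra (with the same vacuum vector and the same conformal vector $\omega$ as $V$) isomorphic to $M(1)$. Regard $V$ as an $M(1)$-module through such an isomorphism, and suppose that $V$ and $V_L$ are isomorphic as $M(1)$-modules. Then $V$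 and $V_L$ are isomorphic as vertex operator algebras, i.e. there is a linear isomorphism $V\to V_L$ that respects all $n$-th products, the vacuum vectors and the conformal vectors. -/

import Mathlib

open scoped BigOperators

noncomputable section

namespace VOA

/-! ### Vertex operators given by their modes -/

section Modes

variable {V : Type*} [AddCommGroup V] [Module ℂ V]

/-- A family of modes `a_n` is truncated if `a_n v = 0` for all large `n`, for each `v`. -/
def Truncated (f : ℤ → Module.End ℂ V) : Prop :=
  ∀ v, ∃ N : ℤ, ∀ n, N ≤ n → f n v = 0

/-- The vertex operator `∑ n, f n z^(-n-1)` with modes `f n`. -/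
def ofModes (f : ℤ → Module.End ℂ V) (hf : Truncated f) : VertexOperator ℂ V :=
  VertexOperator.of_coeff (fun r => f (-r - 1)) (fun v => by
    obtain ⟨N, hN⟩ := hf v
    refine ⟨-N, fun r hr => ?_⟩
    by_contra hlt
    exact hr (hN (-r - 1) (by omega)))

/-- The `n`-th mode `a_n` of the vertex operator `A(z) = ∑ n, a_n z^(-n-1)`. -/
abbrev mode (A : VertexOperator ℂ V) (n : ℤ) : Module.End ℂ V := VertexOperator.ncoeff A n

theorem mode_ofModes (f : ℤ → Module.End ℂ V) (hf : Truncated f) (n : ℤ) :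
    mode (ofModes f hf) n = f n := by
  simp [mode, ofModes]

theorem truncated_mode (A : VertexOperator ℂ V) : Truncated (mode A) := by
  intro v
  refine ⟨-((HahnModule.of ℂ).symm (A v)).order, fun n hn => ?_⟩
  exact VertexOperator.ncoeff_eq_zero_of_lt_order A n v (by omega)

/-- The summands of the `n`-th mode of the `m`-th residue product of `A(z)` and `B(z)`. -/
def resTerm (A B : VertexOperator ℂ V) (m n : ℤ) (j : ℕ) : Module.End ℂ V :=
  ((-1 : ℂ) ^ j * (Ring.choose m j : ℤ)) •
    (mode A (m - j) * mode B (n + j) - ((-1 : ℂ) ^ m) • (mode B (m + n - j) * mode A j))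

theorem resTerm_finite (A B : VertexOperator ℂ V) (m n : ℤ) (v : V) :
    (Function.support fun j : ℕ => resTerm A B m n j v).Finite := by
  obtain ⟨N₁, h₁⟩ := truncated_mode B v
  obtain ⟨N₂, h₂⟩ := truncated_mode A v
  refine (Set.finite_Iio (max (N₁ - n) N₂).toNat).subset fun j hj => ?_
  by_contra hge
  rw [Set.mem_Iio, not_lt] at hge
  have hge' : max (N₁ - n) N₂ ≤ (j : ℤ) := Int.toNat_le.mp hge
  apply hj
  simp [resTerm, h₁ (n + j) (by have := le_max_left (N₁ - n) N₂; omega),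
    h₂ j ((le_max_right _ _).trans hge')]

theorem exists_bound (A : VertexOperator ℂ V) (w : ℕ → V) (K : ℕ) :
    ∃ N : ℤ, ∀ j < K, ∀ n, N ≤ n → mode A n (w j) = 0 := by
  induction K with
  | zero => exact ⟨0, fun j hj => absurd hj (Nat.not_lt_zero j)⟩
  | succ K ih =>
    obtain ⟨N, hN⟩ := ih
    obtain ⟨M, hM⟩ := truncated_mode A (w K)
    refine ⟨max N M, fun j hj n hn => ?_⟩
    rcases Nat.lt_succ_iff_lt_or_eq.mp hj with h | h
    · exact hN j h n ((le_max_left _ _).trans hn)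
    · subst h
      exact hM n ((le_max_right _ _).trans hn)

/-- The `n`-th mode of the `m`-th residue product:
`∑ j ≥ 0, (-1)^j (m choose j) (A_{m-j} B_{n+j} - (-1)^m B_{m+n-j} A_j)`
(a finite sum on each vector). -/
def resMode (A B : VertexOperator ℂ V) (m n : ℤ) : Module.End ℂ V where
  toFun v := ∑ᶠ j : ℕ, resTerm A B m n j v
  map_add' v w := by
    simp only [map_add]
    exact finsum_add_distrib (resTerm_finite A B m n v) (resTerm_finite A B m n w)
  map_smul' c v := by
    simp only [map_smul, RingHom.id_apply]
    exact (smul_finsum' c (resTerm_finite A B m n v)).symm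

theorem truncated_resMode (A B : VertexOperator ℂ V) (m : ℤ) : Truncated (resMode A B m) := by
  intro v
  obtain ⟨N₁, h₁⟩ := truncated_mode B v
  obtain ⟨N₂, h₂⟩ := truncated_mode A v
  obtain ⟨N₃, h₃⟩ := exists_bound B (fun j => mode A j v) N₂.toNat
  refine ⟨max N₁ (N₃ - m + N₂.toNat), fun n hn => ?_⟩
  have hn₁ := (le_max_left _ _).trans hn
  have hn₃ := (le_max_right _ _).trans hn
  change ∑ᶠ j : ℕ, resTerm A B m n j v = 0
  refine finsum_eq_zero_of_forall_eq_zero fun j => ?_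
  have hB : mode B (n + j) v = 0 := h₁ _ (by omega)
  have hA : mode B (m + n - j) (mode A j v) = 0 := by
    by_cases hj : j < N₂.toNat
    · exact h₃ j hj _ (by omega)
    · rw [h₂ j (by omega), map_zero]
  simp [resTerm, hB, hA]

/-- The `m`-th residue product `A(z)_(m) B(z)`. For `m = -k-1 < 0` this is the normally ordered
product `:(∂^k A / k!)(z) B(z):`. -/
def resProd (A : VertexOperator ℂ V) (m : ℤ) (B : VertexOperator ℂ V) : VertexOperator ℂ V :=
  ofModes (resMode A B m) (truncated_resMode A B m)

/-- The normally ordered product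
`:(∂^(m₁) h_{i₁} / m₁!)(z) (∂^(m₂) h_{i₂} / m₂!)(z) ⋯ Γ(z):`, nested to the right, for a list
`(i₁, m₁), (i₂, m₂), …`. -/
def nestedProd {ι : Type*} (h : ι → VertexOperator ℂ V) (Γ : VertexOperator ℂ V)
    (l : List (ι × ℕ)) : VertexOperator ℂ V :=
  l.foldr (fun im A => resProd (h im.1) (-(im.2 : ℤ) - 1) A) Γ

/-- The identity field `Id_V = Id_V z^0`. -/
def idField : VertexOperator ℂ V :=
  ofModes (fun n => if n = -1 then 1 else 0) (fun v => ⟨0, fun n hn => by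
    have h : n ≠ -1 := by omega
    simp [h]⟩)

end Modes

/-! ### Vertex operator algebras -/

/-- The data `(V, Y, 𝟏, ω)` of a vertex operator algebra; the axioms are `VertexData.IsVOA`. -/
structure VertexData (V : Type*) [AddCommGroup V] [Module ℂ V] where
  /-- the state-field map -/
  Y : V →ₗ[ℂ] VertexOperator ℂ V
  /-- the vacuum vector `𝟏` -/
  vac : V
  /-- the conformal (Virasoro) vector `ω` -/
  conf : V

namespace VertexData

variable {V W U : Type*} [AddCommGroup V] [Module ℂ V] [AddCommGroup W] [Module ℂ W]
  [AddCommGroup U] [Module ℂ U]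

/-- The `n`-th product `a_n b`, where `Y(a, z) = ∑ n, a_n z^(-n-1)`. -/
def nprod (S : VertexData V) (a : V) (n : ℤ) (b : V) : V := mode (S.Y a) n b

/-- The operators `L(n)`, where `Y(ω, z) = ∑ n, L(n) z^(-n-2)`. -/
def vir (S : VertexData V) (n : ℤ) : Module.End ℂ V := mode (S.Y S.conf) (n + 1)

/-- The axioms of a vertex operator algebra over `ℂ`. The truncation condition `a_n b = 0` for
large `n` is part of the type of `Y`. -/
structure IsVOA (S : VertexData V) : Prop where
  /-- `Y(𝟏, z) = Id` -/
  vac_nprod : ∀ (n : ℤ) (v : V), S.nprod S.vac n v = if n = -1 then v else 0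
  /-- `Y(a, z)𝟏` is a power series in `z` ... -/
  nprod_vac_of_nonneg : ∀ (a : V) (n : ℤ), 0 ≤ n → S.nprod a n S.vac = 0
  /-- ... with constant term `a` -/
  nprod_vac : ∀ a : V, S.nprod a (-1) S.vac = a
  /-- the Jacobi identity, in components; both sums are finite -/
  jacobi : ∀ (a b c : V) (p q r : ℤ),
    ∑ᶠ j : ℕ, ((Ring.choose p j : ℤ) : ℂ) • S.nprod (S.nprod a (r + j) b) (p + q - j) c =
    ∑ᶠ j : ℕ, ((-1 : ℂ) ^ j * (Ring.choose r j : ℤ)) •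
      (S.nprod a (p + r - j) (S.nprod b (q + j) c) -
        ((-1 : ℂ) ^ r) • S.nprod b (q + r - j) (S.nprod a (p + j) c))
  /-- the Virasoro relations, with some central charge `c` -/
  virasoro : ∃ c : ℂ, ∀ m n : ℤ,
    S.vir m * S.vir n - S.vir n * S.vir m =
      ((m : ℂ) - n) • S.vir (m + n) +
        (if m + n = 0 then ((m : ℂ) ^ 3 - m) / 12 * c else 0) • (1 : Module.End ℂ V)
  /-- `Y(L(-1)a, z) = d/dz Y(a, z)` -/
  deriv : ∀ (a : V) (n : ℤ) (b : V),
    S.nprod (S.vir (-1) a) n b = (-(n : ℂ)) • S.nprod a (n - 1) b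
  /-- `V` is the direct sum of the spaces `V_n = {v | L(0)v = n v}`, `n ∈ ℤ` -/
  graded : DirectSum.IsInternal fun n : ℤ => (S.vir 0).eigenspace (n : ℂ)
  /-- `dim V_n < ∞` -/
  finite_dim : ∀ n : ℤ, FiniteDimensional ℂ ((S.vir 0).eigenspace (n : ℂ))
  /-- `V_n = 0` for `n` sufficiently small -/
  bounded_below : ∃ N : ℤ, ∀ n < N, (S.vir 0).eigenspace (n : ℂ) = ⊥

/-- `V` is simple: `V ≠ 0`, and `0` and `V` are the only subspaces that are stable under all the
operators `a_n`. -/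
def IsSimple (S : VertexData V) : Prop :=
  Nontrivial V ∧ ∀ I : Submodule ℂ V,
    (∀ (a : V) (n : ℤ), ∀ v ∈ I, S.nprod a n v ∈ I) → I = ⊥ ∨ I = ⊤

/-- Homomorphisms of vertex operator algebras: linear maps that respect all `n`-th products, the
vacuum vectors and the conformal vectors. -/
structure IsHom (S : VertexData V) (T : VertexData W) (f : V →ₗ[ℂ] W) : Prop where
  map_nprod : ∀ (a : V) (n : ℤ) (b : V), f (S.nprod a n b) = T.nprod (f a) n (f b)
  map_vac : f S.vac = T.vac
  map_conf : f S.conf = T.conf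

/-- `V` and `W` are isomorphic vertex operator algebras. -/
def Isomorphic (S : VertexData V) (T : VertexData W) : Prop :=
  ∃ e : V ≃ₗ[ℂ] W, IsHom S T e.toLinearMap

/-- `V` and `W` are isomorphic as `U`-modules, where `u ∈ U` acts on `V` by the operators
`(f u)_n` and on `W` by the operators `(g u)_n`. -/
def IsomorphicOver (S : VertexData V) (T : VertexData W) (f : U →ₗ[ℂ] V) (g : U →ₗ[ℂ] W) : Prop :=
  ∃ e : V ≃ₗ[ℂ] W, ∀ (u : U) (n : ℤ) (v : V), e (S.nprod (f u) n v) = T.nprod (g u) n (e v)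

end VertexData

/-! ### The Heisenberg vertex operator algebra -/

section Heisenberg

variable {ι : Type*}

/-- The Fock space `ℂ[h(-n) | h ∈ 𝔥, n > 0]`, where `𝔥` has the basis `h_i`, `i ∈ ι`; the variable
`X (i, m)` is `h_i(-m-1)`. -/
abbrev Fock (ι : Type*) : Type _ := MvPolynomial (ι × ℕ) ℂ

/-- The operator `h_i(n)` on the Fock space `M(1, β)`, where `G i j = (h_i, h_j)` and
`c i = (h_i, β)`: multiplication by `h_i(-m-1)` if `n = -m-1 < 0`, the scalar `c i` if `n = 0`, and
the derivation with `h_j(-m) ↦ n (h_i, h_j) δ_{m,n}` if `n > 0`. -/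
def fockMode (G : Matrix ι ι ℂ) (c : ι → ℂ) (i : ι) (n : ℤ) : Module.End ℂ (Fock ι) :=
  if n < 0 then LinearMap.mulLeft ℂ (MvPolynomial.X (i, (-n - 1).toNat))
  else if n = 0 then c i • 1
  else (MvPolynomial.mkDerivation ℂ fun jm : ι × ℕ =>
    if (jm.2 : ℤ) + 1 = n then (MvPolynomial.C ((n : ℂ) * G i jm.1) : Fock ι) else 0).toLinearMap

theorem exists_fockMode_eq_zero (G : Matrix ι ι ℂ) (i : ι) (f : Fock ι) :
    ∃ N : ℤ, ∀ (c : ι → ℂ) (n : ℤ), N ≤ n → fockMode G c i n f = 0 := by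
  refine ⟨((f.vars.sup fun jm => jm.2) : ℕ) + 2, fun c n hn => ?_⟩
  rw [fockMode, if_neg (by omega), if_neg (by omega)]
  refine MvPolynomial.derivation_eq_zero_of_forall_mem_vars fun jm hjm => ?_
  rw [MvPolynomial.mkDerivation_X, if_neg]
  have : jm.2 ≤ f.vars.sup fun jm => jm.2 := Finset.le_sup (f := fun jm : ι × ℕ => jm.2) hjm
  omega

theorem truncated_fockMode (G : Matrix ι ι ℂ) (c : ι → ℂ) (i : ι) :
    Truncated (fockMode G c i) := fun f =>
  (exists_fockMode_eq_zero G i f).imp fun _ h n hn => h c n hn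

/-- The field `h_i(z) = ∑ n, h_i(n) z^(-n-1)` on `M(1)`. -/
def fockCurrent (G : Matrix ι ι ℂ) (i : ι) : VertexOperator ℂ (Fock ι) :=
  ofModes (fockMode G 0 i) (truncated_fockMode G 0 i)

open Classical in
/-- The conformal vector `½ ∑ u_i(-1)² 𝟏` for an orthonormal basis `u_i` of `𝔥`, written in the
basis `h_i` with the inverse of the Gram matrix `G`. -/
def fockConf [Fintype ι] (G : Matrix ι ι ℂ) : Fock ι :=
  (2⁻¹ : ℂ) • ∑ i, ∑ j, G⁻¹ i j • (MvPolynomial.X (i, 0) * MvPolynomial.X (j, 0))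

/-- The Heisenberg vertex operator algebra `M(1)` of the space `𝔥` with basis `h_i` and
nondegenerate symmetric form `(h_i, h_j) = G i j`. The field of
`h_{i₁}(-m₁-1) ⋯ h_{i_k}(-m_k-1) 𝟏` is the normally ordered product
`:(∂^(m₁) h_{i₁} / m₁!)(z) ⋯ (∂^(m_k) h_{i_k} / m_k!)(z):`, which does not depend on the order in
which the factors are listed. -/
def heisenberg [Fintype ι] (G : Matrix ι ι ℂ) : VertexData (Fock ι) where
  Y := (MvPolynomial.basisMonomials (ι × ℕ) ℂ).constr ℂ fun s =>
    nestedProd (fockCurrent G) idField (Finsupp.toMultiset s).toList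
  vac := 1
  conf := fockConf G

end Heisenberg

/-! ### The lattice vertex operator algebra -/

section Lattice

variable {L : Type*} [AddCommGroup L]

/-- `B` makes the free abelian group `L` a positive-definite even lattice. -/
structure IsPosDefEven (B : LinearMap.BilinForm ℤ L) : Prop where
  symm : ∀ x y, B x y = B y x
  pos : ∀ x, x ≠ 0 → 0 < B x x
  even : ∀ x, Even (B x x)

/-- A normalized 2-cocycle `ε : L × L → {±1}` with `ε(α, β) ε(β, α)⁻¹ = (-1)^(α, β)`, i.e. a
cocycle of a central extension of `L` by `{±1}` with this commutator map. -/
structure Cocycle (B : LinearMap.BilinForm ℤ L) where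
  /-- the values of the cocycle -/
  toFun : L → L → ℤˣ
  zero_left : ∀ α, toFun 0 α = 1
  zero_right : ∀ α, toFun α 0 = 1
  cocycle : ∀ α β γ, toFun α β * toFun (α + β) γ = toFun β γ * toFun α (β + γ)
  commutator : ∀ α β, toFun α β * (toFun β α)⁻¹ = Int.negOnePow (B α β)

variable {ι : Type*} (b : Module.Basis ι ℤ L) (B : LinearMap.BilinForm ℤ L)

/-- The Gram matrix of the basis `b`. -/
def gram : Matrix ι ι ℂ := Matrix.of fun i j => ((B (b i) (b j) : ℤ) : ℂ)

/-- The space `V_L = M(1) ⊗ ℂ[L]`; the element `p ⊗ e^α` is `Finsupp.single α p`. -/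
abbrev LatticeSpace (ι L : Type*) : Type _ := L →₀ Fock ι

/-- The operator `h_i(n)` on `V_L`, where `h_i = b i`; it preserves `M(1) ⊗ e^β` and `h_i(0)` acts
there as `(h_i, β)`. -/
def latticeMode (i : ι) (n : ℤ) : Module.End ℂ (LatticeSpace ι L) :=
  Finsupp.lsum ℂ fun β => Finsupp.lsingle β ∘ₗ
    fockMode (gram b B) (fun k => ((B (b k) β : ℤ) : ℂ)) i n

theorem truncated_of_single {L : Type*} {f : ℤ → Module.End ℂ (LatticeSpace ι L)}
    (hf : ∀ (β : L) (q : Fock ι), ∃ N : ℤ, ∀ n, N ≤ n → f n (Finsupp.single β q) = 0) :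
    Truncated f := by
  intro v
  induction v using Finsupp.induction_linear with
  | zero => exact ⟨0, fun n _ => map_zero _⟩
  | add v w hv hw =>
    obtain ⟨N, hN⟩ := hv
    obtain ⟨M, hM⟩ := hw
    exact ⟨max N M, fun n hn => by
      rw [map_add, hN n ((le_max_left _ _).trans hn), hM n ((le_max_right _ _).trans hn),
        add_zero]⟩
  | single β q => exact hf β q

theorem truncated_latticeMode (i : ι) : Truncated (latticeMode b B i) :=
  truncated_of_single fun β q => by
    obtain ⟨N, hN⟩ := exists_fockMode_eq_zero (gram b B) i q
    refine ⟨N, fun n hn => ?_⟩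
    simp [latticeMode, hN _ n hn]

/-- The field `h_i(z) = ∑ n, h_i(n) z^(-n-1)` on `V_L`. -/
def latticeCurrent (i : ι) : VertexOperator ℂ (LatticeSpace ι L) :=
  ofModes (latticeMode b B i) (truncated_latticeMode b B i)

/-- The element `α(-n)` of the Fock space, for `α ∈ L` and `n > 0`. -/
def creation [Fintype ι] (α : L) (n : ℕ) : Fock ι :=
  ∑ i, ((b.repr α i : ℤ) : ℂ) • MvPolynomial.X (i, n - 1)

/-- The power series `exp(∑_{n > 0} (α(-n) / n) z^n)` of multiplication operators on the Fock
space. -/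
def expCreation [Fintype ι] (α : L) : PowerSeries (Fock ι) :=
  (PowerSeries.exp ℂ).subst
    (PowerSeries.mk fun n => if n = 0 then 0 else ((n : ℂ)⁻¹) • creation b α n)

/-- The coefficient of `z^e` in `expCreation b α`, for `e ∈ ℤ`. -/
def expCreationCoeff [Fintype ι] (α : L) (e : ℤ) : Fock ι :=
  if 0 ≤ e then PowerSeries.coeff e.toNat (expCreation b α) else 0

/-- The operator `exp(-∑_{n > 0} (α(n) / n) w^n)` on the Fock space, where `w = z^(-1)`. Being the
exponential of a derivation that sends `h_j(-m)` to `-(α, h_j) w^m`, it is the homomorphism of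
algebras with `h_j(-m) ↦ h_j(-m) - (α, h_j) w^m`. -/
def expAnnihilation (α : L) : Fock ι →ₐ[ℂ] Polynomial (Fock ι) :=
  MvPolynomial.aeval fun jm : ι × ℕ =>
    Polynomial.C (MvPolynomial.X jm) -
      Polynomial.monomial (jm.2 + 1) (MvPolynomial.C ((B α (b jm.1) : ℤ) : ℂ))

/-- The coefficient of `z^r` in `Y(e^α, z)`, which maps `q ⊗ e^β` to the coefficient of `z^r` in
`ε(α, β) z^(α, β) exp(∑_{n > 0} (α(-n) / n) z^n) exp(-∑_{n > 0} (α(n) / n) z^(-n)) q ⊗ e^(α + β)`. -/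
def expCoeff [Fintype ι] (ε : Cocycle B) (α : L) (r : ℤ) : Module.End ℂ (LatticeSpace ι L) :=
  Finsupp.lsum ℂ fun β => ((ε.toFun α β : ℤ) : ℂ) • (Finsupp.lsingle (α + β) ∘ₗ
    Polynomial.lsum (fun k : ℕ =>
      LinearMap.mulLeft ℂ (expCreationCoeff b α (r - B α β + k))) ∘ₗ
    (expAnnihilation b B α).toLinearMap)

theorem truncated_expCoeff [Fintype ι] (ε : Cocycle B) (α : L) :
    Truncated fun n : ℤ => expCoeff b B ε α (-n - 1) :=
  truncated_of_single fun β q => by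
    refine ⟨(expAnnihilation b B α q).natDegree - B α β, fun n hn => ?_⟩
    have h : Polynomial.lsum (fun k : ℕ => LinearMap.mulLeft ℂ
        (expCreationCoeff b α (-n - 1 - B α β + k))) (expAnnihilation b B α q) = 0 := by
      rw [Polynomial.lsum_apply, Polynomial.sum_def]
      refine Finset.sum_eq_zero fun k hk => ?_
      have := Polynomial.le_natDegree_of_mem_supp k hk
      rw [expCreationCoeff, if_neg (by omega)]
      simp
    simp [expCoeff, h]

/-- The vertex operator `Y(e^α, z)` on `V_L`. -/
def expField [Fintype ι] (ε : Cocycle B) (α : L) : VertexOperator ℂ (LatticeSpace ι L) :=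
  ofModes (fun n => expCoeff b B ε α (-n - 1)) (truncated_expCoeff b B ε α)

/-- The lattice vertex operator algebra `V_L = M(1) ⊗ ℂ[L]`. The vertex operator of
`h_{i₁}(-m₁-1) ⋯ h_{i_k}(-m_k-1) ⊗ e^α` is the normally ordered product
`:(∂^(m₁) h_{i₁} / m₁!)(z) ⋯ (∂^(m_k) h_{i_k} / m_k!)(z) Y(e^α, z):`, which does not depend on the
order in which the factors are listed. -/
def latticeVOA [Fintype ι] (ε : Cocycle B) : VertexData (LatticeSpace ι L) where
  Y := Finsupp.lsum ℂ fun α => (MvPolynomial.basisMonomials (ι × ℕ) ℂ).constr ℂ fun s =>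
    nestedProd (latticeCurrent b B) (expField b B ε α) (Finsupp.toMultiset s).toList
  vac := Finsupp.single 0 1
  conf := Finsupp.single 0 (fockConf (gram b B))

/-- The inclusion of `M(1) = M(1) ⊗ e^0` in `V_L`. -/
def heisenbergInclusion : Fock ι →ₗ[ℂ] LatticeSpace ι L := Finsupp.lsingle 0

end Lattice

end VOA

end

/-!
An isomorphism of `M(1)`-modules identifies `V` with the space `M(1) ⊗ ℂ[L]`, so that the Heisenberg
operators `h_i(n)` on `V` are known; it can be scaled to match the vacuum vectors
(`exists_vac_eq_smul`). What has to be determined are the vertex operators of the vectors `e^α`,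
because every other field of `V` is an iterated residue product of these and of the currents, by
the Jacobi identity (`map_nprod_of_generators`).

The vector `e^α` is a Heisenberg vacuum vector of weight `α`, so
`[h(n), Y(e^α, z)] = (h, α) z^n Y(e^α, z)`, and `Y(e^α, z)` is determined by its values on the
vectors `e^β`. As the conformal vectors of `V` and `M(1)` agree, `L(-1) e^α = α(-1) e^α`, which gives the
differential equation `d/dz Y(e^α, z) = :α(z) Y(e^α, z):`. In components it is a recursion whose
solutions start at `z^(α, β)` with a Heisenberg vacuum vector of weight `α + β`. Since the Gram
matrix is invertible, such a vector is a multiple of `e^(α+β)` (`IsPosDefEven.exists_eq_single`). Hence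
`Y(e^α, z) e^β = c(α, β) z^(α, β) exp(∑_{n > 0} (α(-n) / n) z^n) e^(α+β)` for a scalar `c(α, β)`
(`IsRealization.exists_structureConstant`).

In a simple vertex operator algebra `Y(a, z) w = 0` only if `a = 0` or `w = 0`, so no `c(α, β)`
vanishes. Two instances of the Jacobi identity in which only leading terms survive show that `c` is
a normalized 2-cocycle with commutator `(-1)^(α, β)`. The quotient of `c` by `ε` is then a symmetric
cocycle with values in `ℂˣ`; the abelian extension of `L` that it defines splits, as `L` is free, so
`c` and `ε` differ by a coboundary (`exists_coboundary`, `IsStructureConstant.exists_rescaling`).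
Rescaling the vectors `e^α` accordingly turns the identification of `V` with `M(1) ⊗ ℂ[L]` into an
isomorphism of vertex operator algebras onto `V_L`. That `V_L` satisfies the axioms of a vertex
operator algebra plays no role in the argument.
-/

noncomputable section

namespace VOA

/-! ### Residue products and the Jacobi identity -/

section Modes

variable {V W : Type*} [AddCommGroup V] [Module ℂ V] [AddCommGroup W] [Module ℂ W]

theorem mode_resProd (A B : VertexOperator ℂ V) (m n : ℤ) (v : V) :
    mode (resProd A m B) n v = ∑ᶠ j : ℕ, resTerm A B m n j v := by
  rw [resProd, mode_ofModes]
  rfl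

theorem resProd_intertwine (φ : V ≃ₗ[ℂ] W) {A B : VertexOperator ℂ V} {A' B' : VertexOperator ℂ W}
    (hA : ∀ n v, φ (mode A n v) = mode A' n (φ v)) (hB : ∀ n v, φ (mode B n v) = mode B' n (φ v))
    (m n : ℤ) (v : V) : φ (mode (resProd A m B) n v) = mode (resProd A' m B') n (φ v) := by
  rw [mode_resProd, mode_resProd, AddEquivClass.map_finsum φ]
  refine finsum_congr fun j => ?_
  simp [resTerm, hA, hB]

theorem choose_neg_one_coeff (j : ℕ) :
    ((-1 : ℂ) ^ j * ((Ring.choose (-1 : ℤ) j : ℤ) : ℂ)) = 1 := by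
  rw [Ring.choose_neg (1 : ℤ) j]
  simp [Units.smul_def, Ring.choose_natCast, ← mul_pow]

/-- A residue product with the identity field: `A(z)_(-1) Id = A(z)`. -/
theorem mode_resProd_neg_one_of_id (A B : VertexOperator ℂ V)
    (hB : ∀ n v, mode B n v = if n = -1 then v else 0) (n : ℤ) (v : V) :
    mode (resProd A (-1) B) n v = mode A n v := by
  have hterm (j : ℕ) : resTerm A B (-1) n j v =
      (if n + j = -1 then mode A (-1 - j) v else 0) +
        (if -1 + n - j = -1 then mode A j v else 0) := by
    simp only [resTerm, choose_neg_one_coeff, one_smul, LinearMap.sub_apply,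
      LinearMap.smul_apply, Module.End.mul_apply, hB]
    split_ifs <;> simp
  rw [mode_resProd, finsum_congr hterm]
  rcases lt_or_ge n 0 with hn | hn
  · rw [finsum_eq_single _ (-1 - n).toNat]
    · rw [if_pos (by omega), if_neg (by omega), add_zero]
      congr 2; omega
    · intro j hj
      rw [if_neg (by omega), if_neg (by omega), add_zero]
  · rw [finsum_eq_single _ n.toNat]
    · rw [if_neg (by omega), if_pos (by omega), zero_add]
      congr 2; omega
    · intro j hj
      rw [if_neg (by omega), if_neg (by omega), add_zero]

/-- If a field `A(z)` has the creation property at `v`, so has the residue product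
`h(z)_(-m-1) A(z)`, and its constant term at `v` is `h_{-m-1} A_{-1} v`. -/
theorem resProd_creation (h A : VertexOperator ℂ V) (v : V) (hh : ∀ n, 0 ≤ n → mode h n v = 0)
    (hA : ∀ n, 0 ≤ n → mode A n v = 0) (m : ℕ) :
    (∀ n, 0 ≤ n → mode (resProd h (-(m : ℤ) - 1) A) n v = 0) ∧
      mode (resProd h (-(m : ℤ) - 1) A) (-1) v = mode h (-(m : ℤ) - 1) (mode A (-1) v) := by
  constructor
  · intro n hn
    rw [mode_resProd]
    refine finsum_eq_zero_of_forall_eq_zero fun j => ?_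
    simp [resTerm, hh j (by omega), hA (n + j) (by omega)]
  · rw [mode_resProd, finsum_eq_single _ 0]
    · simp [resTerm, hh 0 le_rfl]
    · intro j hj
      simp [resTerm, hh j (by omega), hA (-1 + j) (by omega)]

end Modes

namespace VertexData

variable {V : Type*} [AddCommGroup V] [Module ℂ V] {S : VertexData V}

theorem zero_nprod (n : ℤ) (v : V) : S.nprod 0 n v = 0 := by
  simp [nprod, mode]

theorem nprod_zero (a : V) (n : ℤ) : S.nprod a n 0 = 0 := map_zero _

theorem smul_nprod (c : ℂ) (a : V) (n : ℤ) (v : V) :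
    S.nprod (c • a) n v = c • S.nprod a n v := by
  simp [nprod, mode]

theorem nprod_smul (c : ℂ) (a : V) (n : ℤ) (v : V) :
    S.nprod a n (c • v) = c • S.nprod a n v := map_smul _ _ _

theorem add_nprod (a a' : V) (n : ℤ) (v : V) :
    S.nprod (a + a') n v = S.nprod a n v + S.nprod a' n v := by
  simp [nprod, mode]

theorem sum_nprod {κ : Type*} (s : Finset κ) (a : κ → V) (n : ℤ) (v : V) :
    S.nprod (∑ i ∈ s, a i) n v = ∑ i ∈ s, S.nprod (a i) n v := by
  simp [nprod, mode]

/-- The field of `a_m b` is the `m`-th residue product of the fields of `a` and `b`. -/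
theorem IsVOA.mode_nprod (hS : S.IsVOA) (a b : V) (m n : ℤ) (c : V) :
    mode (S.Y (S.nprod a m b)) n c = mode (resProd (S.Y a) m (S.Y b)) n c := by
  have h := hS.jacobi a b c 0 n m
  rw [finsum_eq_single _ 0] at h
  · rw [mode_resProd]
    simp only [Nat.cast_zero, add_zero, zero_add, sub_zero, Ring.choose_zero_right, Int.cast_one,
      one_smul] at h
    rw [← nprod, h]
    refine finsum_congr fun j => ?_
    simp [resTerm, nprod, add_comm]
  · intro j hj
    rw [Ring.choose_zero_pos ℤ (by omega)]
    simp

/-- If `h_0 a = c a` and `h_j a = 0` for `j > 0`, then `[h_n, a_k] = c a_{n+k}`. -/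
theorem IsVOA.commutator (hS : S.IsVOA) {h a : V} {c : ℂ} (h0 : S.nprod h 0 a = c • a)
    (hpos : ∀ j : ℤ, 0 < j → S.nprod h j a = 0) (n k : ℤ) (v : V) :
    S.nprod h n (S.nprod a k v) = S.nprod a k (S.nprod h n v) + c • S.nprod a (n + k) v := by
  have H := hS.jacobi h a v n k 0
  rw [finsum_eq_single _ 0, finsum_eq_single _ 0] at H
  · simp only [Nat.cast_zero, add_zero, sub_zero, Ring.choose_zero_right, Int.cast_one,
      one_smul, pow_zero, mul_one, zpow_zero, h0] at H
    rw [eq_comm, sub_eq_iff_eq_add] at H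
    rw [H, add_comm, smul_nprod]
  · intro j hj
    rw [Ring.choose_zero_pos ℤ (by omega)]
    simp
  · intro j hj
    rw [hpos _ (by omega), zero_nprod, smul_zero]

/-- The vectors killed by all modes of `a` form an ideal. By locality of `Y(a, z)` and `Y(b, w)`,
a relation `∑ j, ± (N choose j) a_{p+N-j} b_{q+j} w = 0` holds if `a_n w = 0` for all `n`, and one
descends in the index of `b`. -/
theorem IsVOA.annihilator_nprod (hS : S.IsVOA) {a w : V} (hw : ∀ n, S.nprod a n w = 0)
    (b : V) (m n : ℤ) : S.nprod a n (S.nprod b m w) = 0 := by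
  obtain ⟨N, hN⟩ := truncated_mode (S.Y a) b
  obtain ⟨M, hM⟩ := truncated_mode (S.Y b) w
  have key (d : ℕ) : ∀ m n : ℤ, M - d ≤ m → S.nprod a n (S.nprod b m w) = 0 := by
    induction d with
    | zero =>
      intro m n hm
      rw [show S.nprod b m w = 0 from hM m (by simpa using hm)]
      simp [nprod]
    | succ d ih =>
      intro m n hm
      -- As `a_k b = 0` for `k ≥ N`, the left hand side vanishes for `r = N`.
      have H := hS.jacobi a b w (n - N) m N
      rw [finsum_eq_zero_of_forall_eq_zero, finsum_eq_single _ 0] at H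
      · simpa [hw, nprod_zero] using H.symm
      · intro j hj
        rw [ih (m + j) _ (by push_cast at hm; omega), hw]
        simp [nprod]
      · intro j
        rw [show S.nprod a (N + j) b = 0 from hN _ (by omega), zero_nprod, smul_zero]
  exact key (M - m).toNat m n (by omega)

/-- In a simple vertex operator algebra, `Y(a, z) w = 0` only if `a = 0` or `w = 0`. -/
theorem IsVOA.eq_zero_of_nprod_eq_zero (hS : S.IsVOA) (hs : S.IsSimple) {a w : V}
    (hw : ∀ n, S.nprod a n w = 0) (hw0 : w ≠ 0) : a = 0 := by
  let I : Submodule ℂ V :=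
    { carrier := {w | ∀ n, S.nprod a n w = 0}
      add_mem' := fun {x y} hx hy n => by
        rw [nprod, map_add, ← nprod, ← nprod, hx, hy, add_zero]
      zero_mem' := nprod_zero a
      smul_mem' := fun c x hx n => by rw [nprod_smul, hx, smul_zero] }
  rcases hs.2 I fun b m v hv n => hS.annihilator_nprod hv b m n with h | h
  · exact absurd ((Submodule.mem_bot ℂ).mp (h ▸ (show w ∈ I from hw))) hw0
  · have hv : S.vac ∈ I := h ▸ Submodule.mem_top
    rw [← hS.nprod_vac a]
    exact hv (-1)

/-- The `n`-th mode of `x_{-1} a` on a vector `v` with `x_0 v = c v` and `x_k v = 0` for `k > 0`;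
the sum that occurs is finite. -/
theorem IsVOA.nprod_nprod_neg_one (hS : S.IsVOA) {a x v : V} {c : ℂ}
    (h0 : S.nprod x 0 v = c • v) (hpos : ∀ k : ℤ, 0 < k → S.nprod x k v = 0) (n : ℤ) :
    (Function.support fun j : ℕ => S.nprod x (-(j : ℤ) - 1) (S.nprod a (n + j) v)).Finite ∧
    S.nprod (S.nprod x (-1) a) n v =
      (∑ᶠ j : ℕ, S.nprod x (-(j : ℤ) - 1) (S.nprod a (n + j) v)) + c • S.nprod a (n - 1) v := by
  have hfin : (Function.support
      fun j : ℕ => S.nprod x (-(j : ℤ) - 1) (S.nprod a (n + j) v)).Finite := by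
    obtain ⟨N, hN⟩ := truncated_mode (S.Y a) v
    refine (Set.finite_Iio (N - n).toNat).subset fun j hj => ?_
    by_contra hge
    rw [Set.mem_Iio, not_lt] at hge
    apply hj
    change S.nprod x _ (mode (S.Y a) (n + j) v) = 0
    rw [hN _ (by omega), nprod_zero]
  refine ⟨hfin, ?_⟩
  have hterm (j : ℕ) : resTerm (S.Y x) (S.Y a) (-1) n j v =
      S.nprod x (-(j : ℤ) - 1) (S.nprod a (n + j) v) +
        if j = 0 then c • S.nprod a (n - 1) v else 0 := by
    simp only [resTerm, choose_neg_one_coeff, one_smul, LinearMap.sub_apply, LinearMap.smul_apply,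
      Module.End.mul_apply]
    change S.nprod x (-1 - j) (S.nprod a (n + j) v) -
      (-1 : ℂ) ^ (-1 : ℤ) • S.nprod a (-1 + n - j) (S.nprod x j v) = _
    rw [show (-1 : ℤ) - j = -(j : ℤ) - 1 by ring, show (-1 : ℤ) + n - j = n - 1 - j by ring]
    by_cases hj : j = 0
    · subst hj
      simp [h0, nprod_smul]
    · rw [hpos j (by omega), nprod_zero, if_neg hj]
      simp
  rw [nprod, hS.mode_nprod, mode_resProd, finsum_congr hterm,
    finsum_add_distrib hfin, finsum_eq_single (fun j : ℕ => if j = 0 then _ else _) 0]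
  · simp
  · intro j hj
    simp [hj]
  · refine (Set.finite_singleton 0).subset fun j hj => ?_
    by_contra hne
    exact hj (if_neg hne)

end VertexData

/-! ### The exponential of the creation operators -/

section Creation

variable {L : Type*} [AddCommGroup L] {ι : Type*} [Fintype ι] (b : Module.Basis ι ℤ L)

/-- The differential equation `d/dz E = (∑_{n > 0} α(-n) z^(n-1)) E` of
`E = exp(∑_{n > 0} (α(-n) / n) z^n)`, with the initial value `1`, in terms of coefficients. -/
theorem expCreation_recursion (α : L) :
    PowerSeries.coeff 0 (expCreation b α) = 1 ∧
    ∀ k : ℕ, ((k : ℂ) + 1) • PowerSeries.coeff (k + 1) (expCreation b α) =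
      ∑ j ∈ Finset.range (k + 1),
        creation b α (j + 1) * PowerSeries.coeff (k - j) (expCreation b α) := by
  set a : PowerSeries (Fock ι) :=
    PowerSeries.mk fun n => if n = 0 then 0 else ((n : ℂ)⁻¹) • creation b α n with ha
  have ha0 : PowerSeries.constantCoeff a = 0 := by
    rw [← PowerSeries.coeff_zero_eq_constantCoeff_apply, ha, PowerSeries.coeff_mk, if_pos rfl]
  have hsub : PowerSeries.HasSubst a := PowerSeries.HasSubst.of_constantCoeff_zero' ha0
  -- The chain rule is available only if both series have the same coefficient ring.
  have hE : expCreation b α = (PowerSeries.exp (Fock ι)).subst a := by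
    ext1 n
    rw [expCreation, PowerSeries.coeff_subst' hsub, PowerSeries.coeff_subst' hsub]
    refine finsum_congr fun d => ?_
    rw [PowerSeries.coeff_exp, PowerSeries.coeff_exp, algebraMap_smul, algebraMap_smul]
  have hD : PowerSeries.derivative (Fock ι) (expCreation b α) =
      expCreation b α * PowerSeries.derivative (Fock ι) a := by
    rw [hE, PowerSeries.derivative_subst hsub, PowerSeries.derivative_exp]
  constructor
  · rw [hE, PowerSeries.coeff_subst' hsub, finsum_eq_single _ 0]
    · simp
    · intro d hd
      simp [ha0, hd]
  · intro k
    have h := congrArg (PowerSeries.coeff k) hD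
    rw [PowerSeries.coeff_derivative, mul_comm (expCreation b α), PowerSeries.coeff_mul,
      Finset.Nat.sum_antidiagonal_eq_sum_range_succ_mk] at h
    rw [MvPolynomial.smul_eq_C_mul, mul_comm]
    simp only [map_add, map_natCast, map_one]
    rw [h]
    refine Finset.sum_congr rfl fun j _ => ?_
    congr 1
    rw [PowerSeries.coeff_derivative, ha, PowerSeries.coeff_mk, if_neg (by omega), mul_comm,
      ← Nat.cast_add_one, ← map_natCast (MvPolynomial.C (R := ℂ)), ← MvPolynomial.smul_eq_C_mul,
      smul_smul, mul_inv_cancel₀ (by exact_mod_cast Nat.succ_ne_zero j), one_smul]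

theorem expCreationCoeff_of_neg (α : L) {e : ℤ} (he : e < 0) : expCreationCoeff b α e = 0 :=
  if_neg (by omega)

theorem expCreationCoeff_zero (α : L) : expCreationCoeff b α 0 = 1 := by
  simp [expCreationCoeff, (expCreation_recursion b α).1, -PowerSeries.coeff_zero_eq_constantCoeff]

theorem expCreation_zero (k : ℕ) :
    PowerSeries.coeff (k + 1) (expCreation b (0 : L)) = 0 := by
  have h := (expCreation_recursion b (0 : L)).2 k
  have h0 (n : ℕ) : creation b (0 : L) n = 0 := by simp [creation]
  simp only [h0, zero_mul, Finset.sum_const_zero] at h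
  exact (smul_eq_zero.mp h).resolve_left (by exact_mod_cast Nat.succ_ne_zero k)

theorem expCreationCoeff_of_zero (e : ℤ) :
    expCreationCoeff b (0 : L) e = if e = 0 then 1 else 0 := by
  rcases lt_trichotomy e 0 with h | h | h
  · rw [expCreationCoeff_of_neg b _ h, if_neg (by omega)]
  · rw [h, expCreationCoeff_zero, if_pos rfl]
  · obtain ⟨k, rfl⟩ : ∃ k : ℕ, e = (k + 1 : ℕ) := ⟨(e - 1).toNat, by omega⟩
    rw [expCreationCoeff, if_pos h.le, Int.toNat_natCast, expCreation_zero, if_neg (by omega)]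

end Creation

/-! ### The Heisenberg action on the lattice space -/

section Lattice

variable {L : Type*} [AddCommGroup L] {ι : Type*} (b : Module.Basis ι ℤ L)
  (B : LinearMap.BilinForm ℤ L)

theorem mode_latticeCurrent (i : ι) (n : ℤ) : mode (latticeCurrent b B i) n = latticeMode b B i n :=
  mode_ofModes _ _ _

theorem latticeMode_single (i : ι) (n : ℤ) (β : L) (q : Fock ι) :
    latticeMode b B i n (Finsupp.single β q) =
      Finsupp.single β (fockMode (gram b B) (fun k => ((B (b k) β : ℤ) : ℂ)) i n q) := by
  simp [latticeMode]

theorem latticeMode_apply (i : ι) (n : ℤ) (w : LatticeSpace ι L) (β : L) :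
    latticeMode b B i n w β = fockMode (gram b B) (fun k => ((B (b k) β : ℤ) : ℂ)) i n (w β) := by
  induction w using Finsupp.induction_linear with
  | zero => simp
  | add v w hv hw => simp [hv, hw]
  | single γ q =>
    rw [latticeMode_single]
    by_cases h : γ = β
    · subst h; simp
    · simp [h]

theorem latticeMode_neg_single (i : ι) (m : ℕ) (β : L) (q : Fock ι) :
    latticeMode b B i (-(m : ℤ) - 1) (Finsupp.single β q) =
      Finsupp.single β (MvPolynomial.X (i, m) * q) := by
  rw [latticeMode_single, fockMode, if_pos (by omega)]
  simp

theorem latticeMode_zero_single (i : ι) (β : L) (q : Fock ι) :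
    latticeMode b B i 0 (Finsupp.single β q) = ((B (b i) β : ℤ) : ℂ) • Finsupp.single β q := by
  rw [latticeMode_single, fockMode, if_neg (by omega), if_pos rfl]
  simp

theorem latticeMode_pos_single_one (i : ι) {n : ℤ} (hn : 0 < n) (β : L) (c : ℂ) :
    latticeMode b B i n (Finsupp.single β (MvPolynomial.C c)) = 0 := by
  rw [latticeMode_single, fockMode, if_neg (by omega), if_neg (by omega)]
  simp

/-- The lattice space is generated by the vectors `1 ⊗ e^β` under the creation operators. -/
theorem latticeSpace_induction {L ι : Type*} {P : LatticeSpace ι L → Prop} (h0 : P 0)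
    (hadd : ∀ v w, P v → P w → P (v + w)) (hsmul : ∀ (c : ℂ) v, P v → P (c • v))
    (hone : ∀ β, P (Finsupp.single β 1))
    (hX : ∀ i (m : ℕ) β q, P (Finsupp.single β q) →
      P (Finsupp.single β (MvPolynomial.X (i, m) * q))) (w : LatticeSpace ι L) : P w := by
  induction w using Finsupp.induction_linear with
  | zero => exact h0
  | add v w hv hw => exact hadd v w hv hw
  | single β q =>
    induction q using MvPolynomial.induction_on with
    | C a =>
      have := hsmul a _ (hone β)
      rwa [Finsupp.smul_single, MvPolynomial.smul_eq_C_mul, mul_one] at this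
    | add p q hp hq => rw [Finsupp.single_add]; exact hadd _ _ hp hq
    | mul_X p n hp => rw [mul_comm]; exact hX n.1 n.2 β p hp

variable {B} [Fintype ι]

theorem sum_bilin_repr (α γ : L) :
    ∑ i, ((b.repr α i : ℤ) : ℂ) * ((B (b i) γ : ℤ) : ℂ) = ((B α γ : ℤ) : ℂ) := by
  have h := congrArg (fun x => B x γ) (b.sum_repr α)
  simp only [map_sum, map_smul, LinearMap.sum_apply, LinearMap.smul_apply, smul_eq_mul] at h
  exact_mod_cast h

theorem IsPosDefEven.eq_of_forall (hB : IsPosDefEven B) {β γ : L}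
    (h : ∀ i, B (b i) β = B (b i) γ) : β = γ := by
  have h' : ∀ α, B α β = B α γ := fun α => by
    have h₁ := sum_bilin_repr b (B := B) α β
    rw [Finset.sum_congr rfl fun i _ => by rw [h i], sum_bilin_repr] at h₁
    exact_mod_cast h₁.symm
  by_contra hne
  have hpos := hB.pos _ (sub_ne_zero.mpr hne)
  rw [map_sub, h', sub_self] at hpos
  exact lt_irrefl _ hpos

/-- The Gram matrix of a definite form is invertible: an integer vector in its kernel is a lattice
vector orthogonal to the lattice. -/
theorem IsPosDefEven.isUnit_det_gram [DecidableEq ι] (hB : IsPosDefEven B) :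
    IsUnit (gram b B).det := by
  let G : Matrix ι ι ℤ := Matrix.of fun i j => B (b i) (b j)
  have hG : gram b B = G.map (Int.castRingHom ℂ) := by
    ext i j; simp [gram, G]
  rw [hG, ← RingHom.mapMatrix_apply, ← RingHom.map_det, isUnit_iff_ne_zero]
  intro h0
  have hdet : G.det = 0 := by
    simpa using h0
  obtain ⟨v, hv, hGv⟩ := Matrix.exists_mulVec_eq_zero_iff.mpr hdet
  apply hv
  have h : ∑ i, v i • b i = 0 := by
    refine hB.eq_of_forall b fun i => ?_
    have := congrFun hGv i
    simpa [Matrix.mulVec, dotProduct, G, mul_comm] using this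
  funext i
  exact Fintype.linearIndependent_iff.mp b.linearIndependent v h i

/-- A polynomial killed by all annihilation operators `h_i(n)`, `n > 0`, is constant: the operators
`∂/∂h_j(-n)` are linear combinations of them, as the form is nondegenerate. -/
theorem exists_eq_C_of_fockMode_eq_zero [DecidableEq ι] {G : Matrix ι ι ℂ}
    (hG : IsUnit G.det) (c : ι → ℂ) (q : Fock ι) (hq : ∀ i (n : ℤ), 0 < n → fockMode G c i n q = 0) :
    ∃ a : ℂ, q = MvPolynomial.C a := by
  have hpd (j : ι) (m : ℕ) : MvPolynomial.pderiv (j, m) q = 0 := by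
    let D (i : ι) : Derivation ℂ (Fock ι) (Fock ι) :=
      MvPolynomial.mkDerivation ℂ fun jm : ι × ℕ =>
        if (jm.2 : ℤ) + 1 = (m : ℤ) + 1 then
          (MvPolynomial.C ((((m : ℤ) + 1 : ℤ) : ℂ) * G i jm.1) : Fock ι) else 0
    have hD (i : ι) : D i q = 0 := by
      have := hq i ((m : ℤ) + 1) (by omega)
      rwa [fockMode, if_neg (by omega), if_neg (by omega)] at this
    have hsumD (a : ι → ℂ) (p : Fock ι) : (∑ i, a i • D i) p = ∑ i, a i • D i p := by
      have := congrFun (map_sum Derivation.coeFnAddMonoidHom (fun i => a i • D i) Finset.univ) p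
      exact this.trans (Finset.sum_apply _ _ _)
    have hsum : ((m : ℂ) + 1) • MvPolynomial.pderiv (R := ℂ) (j, m) = ∑ i, G⁻¹ j i • D i := by
      refine MvPolynomial.derivation_ext fun km => ?_
      obtain ⟨k, m'⟩ := km
      have hinv : ∑ i, G⁻¹ j i * G i k = (1 : Matrix ι ι ℂ) j k := by
        rw [← Matrix.nonsing_inv_mul G hG, Matrix.mul_apply]
      have hev : (∑ i, G⁻¹ j i • D i) (MvPolynomial.X (k, m')) =
          ∑ i, G⁻¹ j i • D i (MvPolynomial.X (k, m')) := hsumD _ _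
      rw [hev]
      simp only [D, MvPolynomial.mkDerivation_X, Derivation.smul_apply]
      by_cases hm : m' = m
      · subst hm
        simp only [if_true, MvPolynomial.smul_eq_C_mul, ← MvPolynomial.C_mul]
        rw [← map_sum MvPolynomial.C, show ∑ i, G⁻¹ j i * ((((m' : ℤ) + 1 : ℤ) : ℂ) * G i k) =
          ((m' : ℂ) + 1) * ∑ i, G⁻¹ j i * G i k by
            rw [Finset.mul_sum]; refine Finset.sum_congr rfl fun i _ => ?_; push_cast; ring]
        rw [hinv, Matrix.one_apply]
        by_cases hjk : j = k
        · subst hjk; simp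
        · rw [if_neg hjk, MvPolynomial.pderiv_X_of_ne (by simp [Ne.symm hjk])]; simp
      · rw [MvPolynomial.pderiv_X_of_ne (by simp [hm])]
        simp [hm]
    have := congrArg (fun D : Derivation ℂ (Fock ι) (Fock ι) => D q) hsum
    simp only [Derivation.smul_apply] at this
    rw [show (∑ i, G⁻¹ j i • D i) q = 0 by rw [hsumD]; simp [hD]] at this
    exact (smul_eq_zero.mp this).resolve_left (by exact_mod_cast Nat.succ_ne_zero m)
  refine ⟨MvPolynomial.coeff 0 q, ?_⟩
  ext s
  rw [MvPolynomial.coeff_C]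
  split_ifs with hs
  · rw [hs]
  · obtain ⟨x, hx⟩ := Finsupp.ne_iff.mp (Ne.symm hs)
    have h := MvPolynomial.coeff_pderiv q (s - Finsupp.single x 1) (i := x)
    rw [hpd x.1 x.2, MvPolynomial.coeff_zero, tsub_add_cancel_of_le] at h
    · refine (mul_eq_zero.mp h.symm).resolve_right ?_
      exact Nat.cast_add_one_ne_zero _
    · rw [Finsupp.single_le_iff]
      exact Nat.one_le_iff_ne_zero.mpr hx

/-- A vacuum vector for the Heisenberg algebra of weight `γ` is a multiple of `e^γ`. -/
theorem IsPosDefEven.exists_eq_single (hB : IsPosDefEven B) (γ : L) (w : LatticeSpace ι L)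
    (hpos : ∀ i (n : ℤ), 0 < n → latticeMode b B i n w = 0)
    (hzero : ∀ i, latticeMode b B i 0 w = ((B (b i) γ : ℤ) : ℂ) • w) :
    ∃ c : ℂ, w = Finsupp.single γ (MvPolynomial.C c) := by
  classical
  obtain ⟨c, hc⟩ := exists_eq_C_of_fockMode_eq_zero (hB.isUnit_det_gram b)
    (fun k => ((B (b k) γ : ℤ) : ℂ)) (w γ) fun i n hn => by
      rw [← latticeMode_apply, hpos i n hn]; rfl
  refine ⟨c, ?_⟩
  ext1 β
  by_cases hβ : γ = β
  · subst hβ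
    rw [hc, Finsupp.single_eq_same]
  · rw [Finsupp.single_eq_of_ne' hβ]
    by_contra hne
    refine hβ (hB.eq_of_forall b fun i => ?_).symm
    have h := congrArg (fun w : LatticeSpace ι L => w β) (hzero i)
    simp only [latticeMode_apply, Finsupp.smul_apply] at h
    rw [fockMode, if_neg (by omega), if_pos rfl, LinearMap.smul_apply, Module.End.one_apply] at h
    exact_mod_cast smul_left_injective ℂ hne h

end Lattice

/-! ### The vertex operators of the vectors `e^α` -/

section ExpField

variable {L : Type*} [AddCommGroup L] {ι : Type*} [Fintype ι] (b : Module.Basis ι ℤ L)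
  {B : LinearMap.BilinForm ℤ L} (ε : Cocycle B)

theorem mode_expField (α : L) (n : ℤ) : mode (expField b B ε α) n = expCoeff b B ε α (-n - 1) :=
  mode_ofModes _ _ _

theorem expCoeff_single (α : L) (r : ℤ) (β : L) (q : Fock ι) :
    expCoeff b B ε α r (Finsupp.single β q) = ((ε.toFun α β : ℤ) : ℂ) •
      Finsupp.single (α + β) (Polynomial.lsum (fun k : ℕ =>
        LinearMap.mulLeft ℂ (expCreationCoeff b α (r - B α β + k))) (expAnnihilation b B α q)) := by
  simp [expCoeff]

theorem expCoeff_single_one (α : L) (r : ℤ) (β : L) :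
    expCoeff b B ε α r (Finsupp.single β 1) = ((ε.toFun α β : ℤ) : ℂ) •
      Finsupp.single (α + β) (expCreationCoeff b α (r - B α β)) := by
  rw [expCoeff_single, map_one, Polynomial.lsum_apply, ← Polynomial.C_1,
    Polynomial.sum_C_index (by simp)]
  simp

/-- The commutation relation `[h_i(-m-1), Y(e^α, z)] = (h_i, α) z^(-m-1) Y(e^α, z)`. -/
theorem expCoeff_single_X_mul (hB : IsPosDefEven B) (α : L) (r : ℤ) (i : ι) (m : ℕ) (β : L)
    (q : Fock ι) : expCoeff b B ε α r (Finsupp.single β (MvPolynomial.X (i, m) * q)) =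
      latticeMode b B i (-(m : ℤ) - 1) (expCoeff b B ε α r (Finsupp.single β q)) -
        ((B (b i) α : ℤ) : ℂ) • expCoeff b B ε α (r + m + 1) (Finsupp.single β q) := by
  let Ψ (r : ℤ) : Polynomial (Fock ι) →ₗ[ℂ] Fock ι := Polynomial.lsum fun k : ℕ =>
    LinearMap.mulLeft ℂ (expCreationCoeff b α (r - B α β + k))
  have hΨ (r : ℤ) (k : ℕ) (x : Fock ι) :
      Ψ r (Polynomial.monomial k x) = expCreationCoeff b α (r - B α β + k) * x := by
    simp only [Ψ, Polynomial.lsum_apply]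
    rw [Polynomial.sum_monomial_index _ _ (by simp)]
    simp
  have hmul (l : ℕ) (x : Fock ι) (P : Polynomial (Fock ι)) :
      Ψ r (Polynomial.monomial l x * P) = x * Ψ (r + l) P := by
    induction P using Polynomial.induction_on' with
    | add P Q hP hQ => rw [mul_add, map_add, map_add, hP, hQ, mul_add]
    | monomial k y =>
      rw [Polynomial.monomial_mul_monomial, hΨ, hΨ]
      push_cast
      rw [show r - B α β + ((l : ℤ) + k) = r + l - B α β + k by ring]
      ring
  have hann : expAnnihilation b B α (MvPolynomial.X (i, m) * q) =
      Polynomial.monomial 0 (MvPolynomial.X (i, m)) * expAnnihilation b B α q -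
        Polynomial.monomial (m + 1) (MvPolynomial.C ((B α (b i) : ℤ) : ℂ)) *
          expAnnihilation b B α q := by
    rw [map_mul, ← sub_mul]
    simp [expAnnihilation]
  have hs (r : ℤ) (q : Fock ι) : expCoeff b B ε α r (Finsupp.single β q) =
      ((ε.toFun α β : ℤ) : ℂ) • Finsupp.single (α + β) (Ψ r (expAnnihilation b B α q)) :=
    expCoeff_single b ε α r β q
  rw [hs, hs, hs, hann, map_sub, hmul, hmul, map_smul, latticeMode_neg_single, Finsupp.single_sub,
    smul_sub, hB.symm α (b i), smul_comm ((B (b i) α : ℤ) : ℂ),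
    Finsupp.smul_single ((B (b i) α : ℤ) : ℂ),
    MvPolynomial.smul_eq_C_mul]
  simp [add_assoc]

theorem mode_expField_zero (n : ℤ) (w : LatticeSpace ι L) :
    mode (expField b B ε 0) n w = if n = -1 then w else 0 := by
  have hann (q : Fock ι) : expAnnihilation b B 0 q = Polynomial.C q := by
    rw [expAnnihilation]
    induction q using MvPolynomial.induction_on with
    | C a => simp
    | add p q hp hq => rw [map_add, hp, hq, map_add]
    | mul_X p n hp => rw [map_mul, hp]; simp
  rw [mode_expField]
  induction w using Finsupp.induction_linear with
  | zero => simp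
  | add v w hv hw => rw [map_add, hv, hw]; split_ifs <;> simp
  | single β q =>
    rw [expCoeff_single, hann, Polynomial.lsum_apply, Polynomial.sum_C_index (by simp),
      ε.zero_left, expCreationCoeff_of_zero]
    by_cases hn : n = -1
    · simp [hn]
    · have : ¬ (-n - 1 = 0) := by omega
      simp [hn, this]

/-- The state-field map of `V_L` on the monomial basis. -/
theorem latticeVOA_nprod_monomial (α : L) (s : ι × ℕ →₀ ℕ) (n : ℤ) (w : LatticeSpace ι L) :
    (latticeVOA b B ε).nprod (Finsupp.single α (MvPolynomial.monomial s 1)) n w =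
      mode (nestedProd (latticeCurrent b B) (expField b B ε α) (Finsupp.toMultiset s).toList)
        n w := by
  have hs : MvPolynomial.monomial s (1 : ℂ) = MvPolynomial.basisMonomials (ι × ℕ) ℂ s := by simp
  simp only [VertexData.nprod, latticeVOA, Finsupp.lsum_single]
  rw [hs, Module.Basis.constr_basis]

theorem monomial_one_eq_prod_toList {ι : Type*} (s : ι × ℕ →₀ ℕ) :
    ((Finsupp.toMultiset s).toList.map MvPolynomial.X).prod =
      (MvPolynomial.monomial s 1 : Fock ι) := by
  rw [← Multiset.prod_coe, ← Multiset.map_coe, Multiset.coe_toList, Finsupp.toMultiset_map,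
    Finsupp.prod_toMultiset, Finsupp.prod_mapDomain_index (by simp) (fun _ _ _ => pow_add _ _ _),
    MvPolynomial.monomial_eq, MvPolynomial.C_1, one_mul]

/-- The currents `h_i(z)` are the fields of the states `h_i(-1) 𝟏` of `V_L`. -/
theorem latticeVOA_mode_X (i : ι) (n : ℤ) (w : LatticeSpace ι L) :
    (latticeVOA b B ε).nprod (Finsupp.single 0 (MvPolynomial.X (i, 0))) n w =
      latticeMode b B i n w := by
  rw [MvPolynomial.X, latticeVOA_nprod_monomial]
  simp only [Finsupp.toMultiset_single, one_smul, Multiset.toList_singleton, nestedProd,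
    List.foldr_cons, List.foldr_nil]
  rw [← mode_latticeCurrent]
  exact mode_resProd_neg_one_of_id _ _ (mode_expField_zero b ε) n w

/-- The creation property of `V_L` for the states of `M(1)`. -/
theorem latticeVOA_nprod_vac (u : Fock ι) :
    (latticeVOA b B ε).nprod (Finsupp.single 0 u) (-1) (Finsupp.single 0 1) =
      Finsupp.single 0 u := by
  have hcur (i : ι) (n : ℤ) (hn : 0 ≤ n) :
      mode (latticeCurrent b B i) n (Finsupp.single 0 1) = 0 := by
    rw [mode_latticeCurrent]
    rcases hn.eq_or_lt with h | h
    · rw [← h, latticeMode_zero_single]; simp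
    · simpa using latticeMode_pos_single_one b B i h 0 1
  have hlist (l : List (ι × ℕ)) :
      (∀ n, 0 ≤ n → mode (nestedProd (latticeCurrent b B) (expField b B ε 0) l) n
        (Finsupp.single 0 1) = 0) ∧
      mode (nestedProd (latticeCurrent b B) (expField b B ε 0) l) (-1) (Finsupp.single 0 1) =
        Finsupp.single 0 (l.map MvPolynomial.X).prod := by
    induction l with
    | nil =>
      refine ⟨fun n hn => ?_, ?_⟩
      · exact (mode_expField_zero b ε n _).trans (if_neg (by omega))
      · exact (mode_expField_zero b ε _ _).trans (if_pos rfl)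
    | cons im l ih =>
      have h := resProd_creation (latticeCurrent b B im.1) _ _ (hcur im.1) ih.1 im.2
      refine ⟨h.1, h.2.trans ?_⟩
      rw [ih.2, mode_latticeCurrent, latticeMode_neg_single, List.map_cons, List.prod_cons]
  induction u using MvPolynomial.induction_on' with
  | monomial s a =>
    rw [← mul_one a, ← smul_eq_mul, ← MvPolynomial.smul_monomial, ← Finsupp.smul_single,
      VertexData.smul_nprod, latticeVOA_nprod_monomial, (hlist _).2, monomial_one_eq_prod_toList]
  | add p q hp hq => rw [Finsupp.single_add, VertexData.add_nprod, hp, hq]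

end ExpField

/-! ### The recursion for leading terms -/

section Recursion

theorem eq_zero_of_recursion {W : Type*} [AddCommGroup W] [Module ℂ W] (T : ℕ → Module.End ℂ W)
    (d : ℤ) (F : ℤ → W) (hlow : ∃ N, ∀ r < N, F r = 0)
    (hrec : ∀ r : ℤ, ((r : ℂ) - d) • F r = ∑ᶠ j : ℕ, T j (F (r - 1 - j))) : ∀ r < d, F r = 0 := by
  obtain ⟨N, hN⟩ := hlow
  have key (k : ℕ) : ∀ r < N + k, r < d → F r = 0 := by
    induction k with
    | zero => intro r hr _; exact hN r (by simpa using hr)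
    | succ k ih =>
      intro r hr hd
      have h := hrec r
      rw [finsum_eq_zero_of_forall_eq_zero fun j => by
        rw [ih (r - 1 - j) (by push_cast at hr; omega) (by omega), map_zero]] at h
      exact (smul_eq_zero.mp h).resolve_left (sub_ne_zero.mpr (by exact_mod_cast hd.ne))
  exact fun r hr => key (r + 1 - N).toNat r (by omega) hr

variable {L : Type*} [AddCommGroup L] {ι : Type*} [Fintype ι] (b : Module.Basis ι ℤ L)
  (B : LinearMap.BilinForm ℤ L)

/-- The operator `α(-j-1)` on the lattice space, for `α ∈ L`. -/
def latticeCreation (α : L) (j : ℕ) : Module.End ℂ (LatticeSpace ι L) :=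
  ∑ i, ((b.repr α i : ℤ) : ℂ) • latticeMode b B i (-(j : ℤ) - 1)

theorem latticeCreation_single (α : L) (j : ℕ) (γ : L) (q : Fock ι) :
    latticeCreation b B α j (Finsupp.single γ q) =
      Finsupp.single γ (creation b α (j + 1) * q) := by
  simp only [latticeCreation, LinearMap.sum_apply, LinearMap.smul_apply, latticeMode_neg_single,
    creation, Finset.sum_mul, Finsupp.smul_single, ← Finsupp.single_finsetSum]
  simp

/-- A solution of the recursion `(r - d) F_r = ∑ j, α(-j-1) F_{r-1-j}` that starts with `c e^γ` at
`r = d` is `c exp(∑_{n > 0} (α(-n) / n) z^n) e^γ z^d`. -/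
theorem eq_expCreationCoeff_of_recursion (α γ : L) (d : ℤ) (c : ℂ) (F : ℤ → LatticeSpace ι L)
    (hlow : ∀ r < d, F r = 0) (hd : F d = Finsupp.single γ (MvPolynomial.C c))
    (hrec : ∀ r : ℤ, ((r : ℂ) - d) • F r = ∑ᶠ j : ℕ, latticeCreation b B α j (F (r - 1 - j)))
    (r : ℤ) : F r = c • Finsupp.single γ (expCreationCoeff b α (r - d)) := by
  have key (k : ℕ) : F (d + k) = c • Finsupp.single γ (PowerSeries.coeff k (expCreation b α)) := by
    induction k using Nat.strong_induction_on with
    | _ k ih =>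
      cases k with
      | zero =>
        rw [(expCreation_recursion b α).1, Nat.cast_zero, add_zero, hd, Finsupp.smul_single,
          MvPolynomial.smul_eq_C_mul, mul_one]
      | succ k =>
        have h := hrec (d + (k + 1 : ℕ))
        rw [finsum_eq_sum_of_support_subset (s := Finset.range (k + 1))] at h
        · have hk : (k : ℂ) + 1 ≠ 0 := by exact_mod_cast Nat.succ_ne_zero k
          rw [Finset.sum_congr rfl fun j hj => by
            rw [show d + ((k + 1 : ℕ) : ℤ) - 1 - j = d + ((k - j : ℕ) : ℤ) by
              have := Finset.mem_range.mp hj; omega, ih (k - j) (by omega), map_smul,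
              latticeCreation_single], ← Finset.smul_sum, ← Finsupp.single_finsetSum,
            ← (expCreation_recursion b α).2 k] at h
          rw [← Finsupp.smul_single, smul_comm c] at h
          refine smul_right_injective _ hk (Eq.trans ?_ h)
          simp only
          congr 1
          push_cast; ring
        · intro j hj
          by_contra hge
          apply hj
          simp only [Finset.coe_range, Set.mem_Iio, not_lt] at hge
          exact (congrArg _ (hlow _ (by omega))).trans (map_zero _)
  rcases lt_or_ge r d with h | h
  · rw [hlow r h, expCreationCoeff_of_neg b _ (by omega), Finsupp.single_zero, smul_zero]
  · have := key (r - d).toNat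
    rw [expCreationCoeff, if_pos (by omega), ← this]
    congr 1; omega

end Recursion

/-! ### Symmetric cocycles on a free abelian group -/

section SymmetricCocycle

/-- The underlying set `L × M` of the extension of `L` by `M` that a cocycle defines. -/
@[ext]
structure CocycleExtension (L M : Type*) where
  /-- the projection to the quotient -/
  base : L
  /-- the coordinate in the kernel -/
  fiber : M

variable {L M : Type*} [AddCommGroup L] [CommGroup M]

/-- The abelian extension of `L` by `M` defined by a normalized symmetric cocycle `g`, with
`(α, x) + (β, y) = (α + β, x y g(α, β))`. -/
abbrev CocycleExtension.addCommGroup (g : L → L → M) (h0 : ∀ β, g 0 β = 1)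
    (hsymm : ∀ α β, g α β = g β α)
    (hg : ∀ α β γ, g α β * g (α + β) γ = g β γ * g α (β + γ)) :
    AddCommGroup (CocycleExtension L M) :=
  letI : Zero (CocycleExtension L M) := ⟨⟨0, 1⟩⟩
  letI : Add (CocycleExtension L M) :=
    ⟨fun x y => ⟨x.base + y.base, x.fiber * y.fiber * g x.base y.base⟩⟩
  letI : Neg (CocycleExtension L M) :=
    ⟨fun x => ⟨-x.base, x.fiber⁻¹ * (g (-x.base) x.base)⁻¹⟩⟩
  letI : AddGroup (CocycleExtension L M) := AddGroup.ofLeftAxioms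
    (fun x y z => CocycleExtension.ext (add_assoc _ _ _) (by
      change x.fiber * y.fiber * g x.base y.base * z.fiber * g (x.base + y.base) z.base =
        x.fiber * (y.fiber * z.fiber * g y.base z.base) * g x.base (y.base + z.base)
      have := hg x.base y.base z.base
      calc _ = x.fiber * y.fiber * z.fiber * (g x.base y.base * g (x.base + y.base) z.base) := by
            ac_rfl
        _ = _ := by rw [this]; ac_rfl))
    (fun x => CocycleExtension.ext (zero_add _) (by
      change 1 * x.fiber * g 0 x.base = x.fiber
      rw [h0, one_mul, mul_one]))
    (fun x => CocycleExtension.ext (neg_add_cancel _) (by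
      change x.fiber⁻¹ * (g (-x.base) x.base)⁻¹ * x.fiber * g (-x.base) x.base = 1
      rw [mul_right_comm x.fiber⁻¹, inv_mul_cancel, one_mul, inv_mul_cancel]))
  { add_comm := fun x y => CocycleExtension.ext (add_comm _ _) (by
      change x.fiber * y.fiber * g x.base y.base = y.fiber * x.fiber * g y.base x.base
      rw [hsymm, mul_comm x.fiber]) }

/-- A normalized symmetric 2-cocycle on a free abelian group is a coboundary, since the abelian
extension that it defines splits. -/
theorem exists_coboundary {ι : Type*} (b : Module.Basis ι ℤ L) (g : L → L → M)
    (h0 : ∀ β, g 0 β = 1) (hsymm : ∀ α β, g α β = g β α)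
    (hg : ∀ α β γ, g α β * g (α + β) γ = g β γ * g α (β + γ)) :
    ∃ μ : L → M, μ 0 = 1 ∧ ∀ α β, μ (α + β) = μ α * μ β * g α β := by
  let _ := CocycleExtension.addCommGroup g h0 hsymm hg
  let π : CocycleExtension L M →+ L :=
    { toFun := CocycleExtension.base, map_zero' := rfl, map_add' := fun _ _ => rfl }
  let s : L →ₗ[ℤ] CocycleExtension L M := b.constr ℤ fun i => ⟨b i, 1⟩
  have hs : π.toIntLinearMap ∘ₗ s = LinearMap.id := b.ext fun i => by
    simp [s, π]
  have hbase (α : L) : (s α).base = α := LinearMap.congr_fun hs α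
  refine ⟨fun α => (s α).fiber, ?_, fun α β => ?_⟩
  · change (s 0).fiber = 1
    rw [map_zero]; rfl
  · change (s (α + β)).fiber = _
    rw [map_add]
    change (s α).fiber * (s β).fiber * g (s α).base (s β).base = _
    rw [hbase, hbase]

end SymmetricCocycle

/-! ### The products of the vectors `e^α` -/

section Realization

variable {L : Type*} [AddCommGroup L] {ι : Type*}
  {V : Type*} [AddCommGroup V] [Module ℂ V]

/-- A linear isomorphism of a vertex operator algebra `V` with the space of `V_L` under which the
states `h i` of `V` act as the currents `h_i(z)`, and the vacuum vectors correspond. -/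
structure IsRealization (b : Module.Basis ι ℤ L) (B : LinearMap.BilinForm ℤ L)
    (S : VertexData V) (h : ι → V) (e : V ≃ₗ[ℂ] LatticeSpace ι L) : Prop where
  current : ∀ (i : ι) (n : ℤ) (v : V), e (S.nprod (h i) n v) = latticeMode b B i n (e v)
  vac : e S.vac = Finsupp.single 0 1

/-- The vector of `V` that corresponds to `e^α`. -/
def groupVec (e : V ≃ₗ[ℂ] LatticeSpace ι L) (α : L) : V := e.symm (Finsupp.single α 1)

variable {b : Module.Basis ι ℤ L} {B : LinearMap.BilinForm ℤ L} {S : VertexData V} {h : ι → V}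
  {e : V ≃ₗ[ℂ] LatticeSpace ι L}

namespace IsRealization

theorem nprod_eq (he : IsRealization b B S h e) (i : ι) (n : ℤ) (v : V) :
    S.nprod (h i) n v = e.symm (latticeMode b B i n (e v)) := by
  rw [← he.current, e.symm_apply_apply]

theorem nprod_neg (he : IsRealization b B S h e) (i : ι) (m : ℕ) (β : L) (q : Fock ι) :
    S.nprod (h i) (-(m : ℤ) - 1) (e.symm (Finsupp.single β q)) =
      e.symm (Finsupp.single β (MvPolynomial.X (i, m) * q)) := by
  rw [he.nprod_eq, e.apply_symm_apply, latticeMode_neg_single]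

theorem nprod_zero_groupVec (he : IsRealization b B S h e) (i : ι) (β : L) :
    S.nprod (h i) 0 (groupVec e β) = ((B (b i) β : ℤ) : ℂ) • groupVec e β := by
  rw [he.nprod_eq, groupVec, e.apply_symm_apply, latticeMode_zero_single, map_smul]

theorem nprod_pos_groupVec (he : IsRealization b B S h e) (i : ι) (β : L) (n : ℤ) (hn : 0 < n) :
    S.nprod (h i) n (groupVec e β) = 0 := by
  have := latticeMode_pos_single_one b B i hn β 1
  rw [MvPolynomial.C_1] at this
  rw [he.nprod_eq, groupVec, e.apply_symm_apply, this, map_zero]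

/-- `[h_i(n), (e^α)_k] = (h_i, α) (e^α)_{n+k}`. -/
theorem commutator (he : IsRealization b B S h e) (hS : S.IsVOA) (i : ι) (α : L) (n k : ℤ)
    (v : V) : S.nprod (h i) n (S.nprod (groupVec e α) k v) =
      S.nprod (groupVec e α) k (S.nprod (h i) n v) +
        ((B (b i) α : ℤ) : ℂ) • S.nprod (groupVec e α) (n + k) v :=
  hS.commutator (he.nprod_zero_groupVec i α) (he.nprod_pos_groupVec i α) n k v

theorem groupVec_zero (he : IsRealization b B S h e) : groupVec e (0 : L) = S.vac := by
  rw [groupVec, ← he.vac, e.symm_apply_apply]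

theorem state_eq (he : IsRealization b B S h e) (hS : S.IsVOA) (i : ι) :
    h i = e.symm (Finsupp.single 0 (MvPolynomial.X (i, 0))) := by
  have := he.nprod_neg i 0 0 1
  rw [mul_one] at this
  rw [← this, ← hS.nprod_vac (h i), ← he.vac, e.symm_apply_apply, hS.nprod_vac]
  simp [hS.nprod_vac]

variable [Fintype ι]

/-- `L(-1) e^α = α(-1) e^α`. -/
theorem vir_neg_one_groupVec (he : IsRealization b B S h e) (hB : IsPosDefEven B) (hS : S.IsVOA)
    (hconf : e S.conf = Finsupp.single 0 (fockConf (gram b B))) (α : L) :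
    S.vir (-1) (groupVec e α) =
      ∑ i, ((b.repr α i : ℤ) : ℂ) • S.nprod (h i) (-1) (groupVec e α) := by
  classical
  set G := gram b B with hG
  have hGT : G.transpose = G := by
    ext i j
    simp [hG, gram, hB.symm (b j) (b i)]
  have hinv (i j : ι) : G⁻¹ i j = G⁻¹ j i := by
    conv_lhs => rw [← hGT, ← Matrix.transpose_nonsing_inv, Matrix.transpose_apply]
  have hXX (i j : ι) : S.nprod (h i) (-1) (h j) =
      e.symm (Finsupp.single 0 (MvPolynomial.X (i, 0) * MvPolynomial.X (j, 0))) := by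
    rw [he.state_eq hS j, ← he.nprod_neg]
    simp
  have hω : S.conf = (2⁻¹ : ℂ) • ∑ i, ∑ j, G⁻¹ i j • S.nprod (h i) (-1) (h j) := by
    simp only [hXX, ← map_smul, ← map_sum]
    rw [← e.symm_apply_apply S.conf, hconf, fockConf]
    rw [← Finsupp.smul_single]
    simp only [Finsupp.single_finsetSum, ← Finsupp.smul_single]
  have hterm (i j : ι) : S.nprod (S.nprod (h i) (-1) (h j)) 0 (groupVec e α) =
      ((B (b j) α : ℤ) : ℂ) • S.nprod (h i) (-1) (groupVec e α) +
        ((B (b i) α : ℤ) : ℂ) • S.nprod (h j) (-1) (groupVec e α) := by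
    rw [(hS.nprod_nprod_neg_one (he.nprod_zero_groupVec i α) (he.nprod_pos_groupVec i α) 0).2,
      finsum_eq_single _ 0]
    · simp [he.nprod_zero_groupVec, VertexData.nprod_smul]
    · intro k hk
      rw [he.nprod_pos_groupVec _ _ _ (by omega), VertexData.nprod_zero]
  have hcoef (i : ι) : ∑ j, G⁻¹ i j * ((B (b j) α : ℤ) : ℂ) = ((b.repr α i : ℤ) : ℂ) := by
    have hGa : (fun j => ((B (b j) α : ℤ) : ℂ)) =
        Matrix.mulVec G fun k => ((b.repr α k : ℤ) : ℂ) := by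
      funext j
      rw [hB.symm, ← sum_bilin_repr b α (b j)]
      simp only [Matrix.mulVec, dotProduct, hG, gram, Matrix.of_apply]
      exact Finset.sum_congr rfl fun k _ => by rw [mul_comm, hB.symm]
    have := congrFun (Matrix.mulVec_mulVec (fun k => ((b.repr α k : ℤ) : ℂ)) G⁻¹ G) i
    rw [← hGa, Matrix.nonsing_inv_mul G (hB.isUnit_det_gram b), Matrix.one_mulVec] at this
    exact this
  have hsum (u : ι → V) : ∑ i, ∑ j, (G⁻¹ i j * ((B (b j) α : ℤ) : ℂ)) • u i =
      ∑ i, ((b.repr α i : ℤ) : ℂ) • u i :=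
    Finset.sum_congr rfl fun i _ => by rw [← Finset.sum_smul, hcoef]
  have hsum' (u : ι → V) : ∑ i, ∑ j, (G⁻¹ i j * ((B (b i) α : ℤ) : ℂ)) • u j =
      ∑ i, ((b.repr α i : ℤ) : ℂ) • u i := by
    rw [Finset.sum_comm, ← hsum]
    exact Finset.sum_congr rfl fun i _ => Finset.sum_congr rfl fun j _ => by rw [hinv]
  change S.nprod S.conf (-1 + 1) _ = _
  rw [neg_add_cancel, hω, VertexData.smul_nprod]
  simp only [VertexData.sum_nprod, VertexData.smul_nprod, hterm, smul_add, smul_smul,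
    Finset.sum_add_distrib]
  rw [hsum fun i => S.nprod (h i) (-1) (groupVec e α),
    hsum' fun i => S.nprod (h i) (-1) (groupVec e α), ← add_smul]
  norm_num

/-- The differential equation `d/dz Y(e^α, z) = :α(z) Y(e^α, z):`, applied to `e^β`, in terms of
the coefficients of `z^r`. -/
theorem recursion (he : IsRealization b B S h e) (hB : IsPosDefEven B) (hS : S.IsVOA)
    (hconf : e S.conf = Finsupp.single 0 (fockConf (gram b B))) (α β : L) (r : ℤ) :
    ((r : ℂ) - (B α β : ℤ)) • e (S.nprod (groupVec e α) (-r - 1) (groupVec e β)) =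
      ∑ᶠ j : ℕ, latticeCreation b B α j
        (e (S.nprod (groupVec e α) (-(r - 1 - j) - 1) (groupVec e β))) := by
  have H := hS.deriv (groupVec e α) (-r) (groupVec e β)
  rw [he.vir_neg_one_groupVec hB hS hconf, VertexData.sum_nprod] at H
  have hi (i : ι) := hS.nprod_nprod_neg_one (a := groupVec e α) (he.nprod_zero_groupVec i β)
    (he.nprod_pos_groupVec i β) (-r)
  rw [Finset.sum_congr rfl fun i _ => by
    rw [VertexData.smul_nprod, (hi i).2, smul_add, smul_smul,
      smul_finsum' _ (hi i).1], Finset.sum_add_distrib, ← Finset.sum_smul, sum_bilin_repr,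
    ← finsum_sum_comm] at H
  · have H' := congrArg e (eq_sub_of_add_eq H)
    rw [AddEquivClass.map_finsum e] at H'
    rw [← map_smul, sub_smul]
    push_cast at H'
    rw [neg_neg] at H'
    rw [← H']
    refine finsum_congr fun j => ?_
    simp only [latticeCreation, map_sum, map_smul, LinearMap.sum_apply, LinearMap.smul_apply,
      he.current]
    rw [show -(r - 1 - j) - 1 = -r + j by ring]
  · intro i _
    refine (hi i).1.subset fun j hj hz => hj ?_
    simp only at hz ⊢
    rw [hz, smul_zero]

/-- `Y(e^α, z) e^β` is a multiple of `z^(α, β) exp(∑_{n > 0} (α(-n) / n) z^n) e^(α+β)`. -/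
theorem exists_structureConstant (he : IsRealization b B S h e) (hB : IsPosDefEven B)
    (hS : S.IsVOA) (hconf : e S.conf = Finsupp.single 0 (fockConf (gram b B))) (α β : L) :
    ∃ c : ℂ, ∀ n : ℤ, e (S.nprod (groupVec e α) n (groupVec e β)) =
      c • Finsupp.single (α + β) (expCreationCoeff b α (-n - 1 - B α β)) := by
  let F (r : ℤ) : LatticeSpace ι L := e (S.nprod (groupVec e α) (-r - 1) (groupVec e β))
  have hrec (r : ℤ) : ((r : ℂ) - (B α β : ℤ)) • F r =
      ∑ᶠ j : ℕ, latticeCreation b B α j (F (r - 1 - j)) := he.recursion hB hS hconf α β r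
  have hlow : ∀ r < B α β, F r = 0 := by
    refine eq_zero_of_recursion _ _ F ?_ hrec
    obtain ⟨N, hN⟩ := truncated_mode (S.Y (groupVec e α)) (groupVec e β)
    refine ⟨-N, fun r hr => ?_⟩
    change e (mode (S.Y (groupVec e α)) (-r - 1) (groupVec e β)) = 0
    rw [hN _ (by omega), map_zero]
  have hcur (i : ι) (n r : ℤ) : latticeMode b B i n (F r) =
      e (S.nprod (groupVec e α) (-r - 1) (S.nprod (h i) n (groupVec e β))) +
        ((B (b i) α : ℤ) : ℂ) • F (r - n) := by
    rw [← he.current, he.commutator hS, map_add, map_smul]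
    simp only [F]
    rw [show -(r - n) - 1 = n + (-r - 1) by ring]
  obtain ⟨c, hc⟩ := hB.exists_eq_single b (α + β) (F (B α β))
    (fun i n hn => by
      rw [hcur, he.nprod_pos_groupVec i β n hn, VertexData.nprod_zero, map_zero,
        hlow _ (by omega), smul_zero, add_zero])
    (fun i => by
      rw [hcur, he.nprod_zero_groupVec, VertexData.nprod_smul, map_smul, sub_zero, map_add,
        Int.cast_add, add_smul, add_comm])
  refine ⟨c, fun n => ?_⟩
  rw [← eq_expCreationCoeff_of_recursion b B α (α + β) (B α β) c F hlow hc hrec]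
  simp only [F]
  rw [show -(-n - 1) - 1 = n by ring]

end IsRealization

end Realization

/-! ### The cocycle of structure constants -/

section Realization

variable {L : Type*} [AddCommGroup L] {ι : Type*}
  {V : Type*} [AddCommGroup V] [Module ℂ V]
  {b : Module.Basis ι ℤ L} {B : LinearMap.BilinForm ℤ L} {S : VertexData V} {h : ι → V}
  {e : V ≃ₗ[ℂ] LatticeSpace ι L}

theorem groupVec_ne_zero {L ι V : Type*} [AddCommGroup V] [Module ℂ V]
    (e : V ≃ₗ[ℂ] LatticeSpace ι L) (α : L) : groupVec e α ≠ 0 := by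
  simp [groupVec]

/-- The scalars `c(α, β)` with
`Y(e^α, z) e^β = c(α, β) z^(α, β) exp(∑_{n > 0} (α(-n) / n) z^n) e^(α+β)`. -/
def IsStructureConstant [Fintype ι] (b : Module.Basis ι ℤ L) (B : LinearMap.BilinForm ℤ L)
    (S : VertexData V) (e : V ≃ₗ[ℂ] LatticeSpace ι L) (c : L → L → ℂ) : Prop :=
  ∀ (α β : L) (n : ℤ), S.nprod (groupVec e α) n (groupVec e β) =
    c α β • e.symm (Finsupp.single (α + β) (expCreationCoeff b α (-n - 1 - B α β)))

namespace IsStructureConstant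

variable [Fintype ι] {c : L → L → ℂ}

theorem nprod_leading (hc : IsStructureConstant b B S e c) {α β : L} {n : ℤ}
    (hn : n = -B α β - 1) :
    S.nprod (groupVec e α) n (groupVec e β) = c α β • groupVec e (α + β) := by
  rw [hc, show -n - 1 - B α β = 0 by omega, expCreationCoeff_zero, groupVec]

theorem nprod_eq_zero (hc : IsStructureConstant b B S e c) {α β : L} {n : ℤ} (hn : -B α β ≤ n) :
    S.nprod (groupVec e α) n (groupVec e β) = 0 := by
  rw [hc, expCreationCoeff_of_neg _ _ (by omega), Finsupp.single_zero, map_zero, smul_zero]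

theorem zero_left (hc : IsStructureConstant b B S e c) (he : IsRealization b B S h e)
    (hS : S.IsVOA) (β : L) : c 0 β = 1 := by
  have H := hc.nprod_leading (α := 0) (β := β) (n := -1) (by simp)
  rw [he.groupVec_zero, hS.vac_nprod, if_pos rfl, zero_add] at H
  refine (smul_left_injective ℂ (groupVec_ne_zero e β) ?_).symm
  simpa using H

theorem zero_right (hc : IsStructureConstant b B S e c) (he : IsRealization b B S h e)
    (hS : S.IsVOA) (α : L) : c α 0 = 1 := by
  have H := hc.nprod_leading (α := α) (β := 0) (n := -1) (by simp)
  rw [he.groupVec_zero, hS.nprod_vac, add_zero] at H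
  refine (smul_left_injective ℂ (groupVec_ne_zero e α) ?_).symm
  simpa using H

theorem ne_zero (hc : IsStructureConstant b B S e c) (hS : S.IsVOA) (hs : S.IsSimple) (α β : L) :
    c α β ≠ 0 := fun h0 =>
  groupVec_ne_zero e α (hS.eq_zero_of_nprod_eq_zero hs
    (fun n => by rw [hc, h0, zero_smul]) (groupVec_ne_zero e β))

/-- The Jacobi identity for `e^α, e^β, e^γ` with `r = -(α, β) - 1`, where only the leading term
survives on the left hand side. -/
theorem jacobi_leading (hc : IsStructureConstant b B S e c) (hS : S.IsVOA) {α β γ : L} (p q : ℤ)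
    (hpq : p + q = -B α γ - B β γ - 1) :
    (c α β * c (α + β) γ) • groupVec e (α + β + γ) =
    ∑ᶠ j : ℕ, ((-1 : ℂ) ^ j * (Ring.choose (-B α β - 1) j : ℤ)) •
      (S.nprod (groupVec e α) (p + (-B α β - 1) - j)
          (S.nprod (groupVec e β) (q + j) (groupVec e γ)) -
        ((-1 : ℂ) ^ (-B α β - 1)) • S.nprod (groupVec e β) (q + (-B α β - 1) - j)
          (S.nprod (groupVec e α) (p + j) (groupVec e γ))) := by
  rw [← hS.jacobi, finsum_eq_single _ 0]
  · rw [hc.nprod_leading (α := α) (β := β) (by simp), VertexData.smul_nprod,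
      hc.nprod_leading (α := α + β) (β := γ) (by simp; omega)]
    simp [smul_smul]
  · intro j hj
    rw [hc.nprod_eq_zero (by omega), VertexData.zero_nprod, smul_zero]

/-- Associativity: in the Jacobi identity only the product `(e^α)_m (e^β)_n e^γ` of leading terms
remains. -/
theorem cocycle (hc : IsStructureConstant b B S e c) (hS : S.IsVOA) (α β γ : L) :
    c α β * c (α + β) γ = c β γ * c α (β + γ) := by
  have H := hc.jacobi_leading hS (α := α) (β := β) (γ := γ) (-B α γ) (-B β γ - 1) (by ring)
  rw [finsum_eq_single _ 0] at H
  · rw [hc.nprod_eq_zero (α := α) (β := γ) (by omega), VertexData.nprod_zero, smul_zero, sub_zero,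
      hc.nprod_leading (α := β) (β := γ) (by simp), VertexData.nprod_smul,
      hc.nprod_leading (α := α) (β := β + γ) (by simp; ring), ← add_assoc] at H
    refine smul_left_injective ℂ (groupVec_ne_zero e (α + β + γ)) ?_
    simpa [smul_smul] using H
  · intro j hj
    rw [hc.nprod_eq_zero (α := α) (β := γ) (by omega), VertexData.nprod_zero, smul_zero, sub_zero,
      hc.nprod_eq_zero (α := β) (β := γ) (by omega), VertexData.nprod_zero, smul_zero]

/-- Commutativity: in the Jacobi identity with `γ = 0` only the product `(e^β)_n (e^α)_m 𝟏` of
leading terms remains. -/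
theorem commutator (hc : IsStructureConstant b B S e c) (he : IsRealization b B S h e)
    (hB : IsPosDefEven B) (hS : S.IsVOA) (α β : L) :
    c α β = ((Int.negOnePow (B α β) : ℤ) : ℂ) * c β α := by
  have H := hc.jacobi_leading hS (α := α) (β := β) (γ := 0) (-1) 0 (by simp)
  rw [finsum_eq_single _ 0] at H
  · rw [hc.nprod_eq_zero (α := β) (β := 0) (by simp), VertexData.nprod_zero, zero_sub,
      hc.nprod_leading (α := α) (β := 0) (by simp), VertexData.nprod_smul, hc.zero_right he hS,
      hc.zero_right he hS, one_smul, mul_one, add_zero, add_zero,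
      hc.nprod_leading (α := β) (β := α) (by rw [hB.symm β α]; simp), add_comm β α] at H
    refine smul_left_injective ℂ (groupVec_ne_zero e (α + β)) ?_
    have hsign : -(-1 : ℂ) ^ (-B α β - 1) = ((Int.negOnePow (B α β) : ℤ) : ℂ) := by
      rw [Int.cast_negOnePow, zpow_sub₀ (by norm_num), zpow_neg, zpow_one, ← inv_zpow]
      norm_num [div_neg]
    rw [← hsign]
    simpa [smul_smul] using H
  · intro j hj
    rw [hc.nprod_eq_zero (α := β) (β := 0) (by simp), VertexData.nprod_zero, zero_sub,
      hc.nprod_eq_zero (α := α) (β := 0) (by simp; omega), VertexData.nprod_zero, smul_zero,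
      neg_zero, smul_zero]

/-- The structure constants of a simple vertex operator algebra differ from `ε` by a coboundary: the
quotient of two cocycles with the same commutator is symmetric. -/
theorem exists_rescaling (hc : IsStructureConstant b B S e c) (he : IsRealization b B S h e)
    (hB : IsPosDefEven B) (hS : S.IsVOA) (hs : S.IsSimple) (ε : Cocycle B) :
    ∃ x : L → ℂˣ, x 0 = 1 ∧
      ∀ α β, c α β * x (α + β) = x α * x β * ((ε.toFun α β : ℤ) : ℂ) := by
  let ρ : ℤˣ →* ℂˣ := Units.map (Int.castRingHom ℂ : ℤ →* ℂ)
  let C (α β : L) : ℂˣ := Units.mk0 (c α β) (hc.ne_zero hS hs α β)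
  have hC0 (β : L) : C 0 β = 1 := Units.ext (hc.zero_left he hS β)
  have hCc (α β γ : L) : C α β * C (α + β) γ = C β γ * C α (β + γ) :=
    Units.ext (hc.cocycle hS α β γ)
  have hCs (α β : L) : C α β = ρ (Int.negOnePow (B α β)) * C β α :=
    Units.ext (hc.commutator he hB hS α β)
  obtain ⟨μ, hμ0, hμ⟩ := exists_coboundary b (fun α β => C α β * (ρ (ε.toFun α β))⁻¹)
    (fun β => by rw [hC0, ε.zero_left, map_one, inv_one, one_mul])
    (fun α β => by
      rw [hCs, ← ε.commutator, map_mul, map_inv]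
      rw [mul_comm (ρ (ε.toFun α β)), mul_right_comm, mul_inv_cancel_right, mul_comm])
    (fun α β γ => by
      calc _ = C α β * C (α + β) γ * (ρ (ε.toFun α β * ε.toFun (α + β) γ))⁻¹ := by
            rw [map_mul, mul_inv]; ac_rfl
        _ = _ := by rw [hCc, ε.cocycle, map_mul, mul_inv]; ac_rfl)
  refine ⟨fun α => (μ α)⁻¹, by simp only [hμ0, inv_one], fun α β => ?_⟩
  have H : C α β * (μ (α + β))⁻¹ = (μ α)⁻¹ * (μ β)⁻¹ * ρ (ε.toFun α β) := by
    rw [hμ]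
    simp only [mul_inv, inv_inv]
    calc _ = (μ α)⁻¹ * (μ β)⁻¹ * ρ (ε.toFun α β) * (C α β * (C α β)⁻¹) := by ac_rfl
      _ = _ := by rw [mul_inv_cancel, mul_one]
  exact congrArg Units.val H

end IsStructureConstant

end Realization

/-! ### The isomorphism -/

section Rescaling

variable {L : Type*} {ι : Type*}

/-- The automorphism `p ⊗ e^α ↦ x(α) p ⊗ e^α` of the lattice space. -/
def rescale (x : L → ℂˣ) : LatticeSpace ι L ≃ₗ[ℂ] LatticeSpace ι L :=
  LinearEquiv.ofLinearMap
    (Finsupp.lsum ℂ fun α => (x α : ℂ) • Finsupp.lsingle α)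
    (Finsupp.lsum ℂ fun α => ((x α)⁻¹ : ℂ) • Finsupp.lsingle α)
    (Finsupp.lhom_ext fun α p => by simp [smul_smul])
    (Finsupp.lhom_ext fun α p => by simp [smul_smul])

theorem rescale_single (x : L → ℂˣ) (α : L) (p : Fock ι) :
    rescale x (Finsupp.single α p) = (x α : ℂ) • Finsupp.single α p := by
  simp [rescale]

theorem rescale_latticeMode [AddCommGroup L] (b : Module.Basis ι ℤ L)
    (B : LinearMap.BilinForm ℤ L) (x : L → ℂˣ) (i : ι) (n : ℤ) (w : LatticeSpace ι L) :
    rescale x (latticeMode b B i n w) = latticeMode b B i n (rescale x w) := by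
  induction w using Finsupp.induction_linear with
  | zero => simp
  | add v w hv hw => simp only [map_add, hv, hw]
  | single β q => rw [rescale_single, map_smul, latticeMode_single, rescale_single]

end Rescaling

section Isomorphism

variable {L : Type*} [AddCommGroup L] {ι : Type*} [Fintype ι]
  {V : Type*} [AddCommGroup V] [Module ℂ V]
  {b : Module.Basis ι ℤ L} {B : LinearMap.BilinForm ℤ L} {S : VertexData V} {h : ι → V}
  {e : V ≃ₗ[ℂ] LatticeSpace ι L}

/-- A rescaling that turns the structure constants `c` into `ε` makes `Y(e^α, z)` on `V` and
on `V_L` correspond: they agree on the vectors `e^β`, and they have the same commutators with the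
currents. -/
theorem IsRealization.rescale_nprod_groupVec (he : IsRealization b B S h e) (hB : IsPosDefEven B)
    (hS : S.IsVOA) {c : L → L → ℂ} (hc : IsStructureConstant b B S e c) (ε : Cocycle B)
    {x : L → ℂˣ} (hx : ∀ α β, c α β * x (α + β) = x α * x β * ((ε.toFun α β : ℤ) : ℂ))
    (α : L) (n : ℤ) (v : V) :
    rescale x (e (S.nprod (groupVec e α) n v)) =
      (x α : ℂ) • expCoeff b B ε α (-n - 1) (rescale x (e v)) := by
  suffices H : ∀ w : LatticeSpace ι L, ∀ n : ℤ,
      rescale x (e (S.nprod (groupVec e α) n (e.symm w))) =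
        (x α : ℂ) • expCoeff b B ε α (-n - 1) (rescale x w) by
    simpa using H (e v) n
  intro w
  induction w using latticeSpace_induction with
  | h0 => intro n; simp [VertexData.nprod_zero]
  | hadd v w hv hw =>
    intro n
    have hadd : S.nprod (groupVec e α) n (e.symm (v + w)) =
        S.nprod (groupVec e α) n (e.symm v) + S.nprod (groupVec e α) n (e.symm w) := by
      rw [map_add]; exact map_add _ _ _
    rw [hadd, map_add, map_add, hv, hw, map_add, map_add, smul_add]
  | hsmul a v hv =>
    intro n
    rw [map_smul, VertexData.nprod_smul, map_smul, map_smul, hv, map_smul, map_smul,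
      smul_comm a]
  | hone β =>
    intro n
    change rescale x (e (S.nprod (groupVec e α) n (groupVec e β))) = _
    rw [hc, map_smul, e.apply_symm_apply, map_smul, rescale_single, rescale_single, map_smul,
      expCoeff_single_one, smul_smul, smul_smul, smul_smul, hx]
  | hX i m β q ih =>
    intro n
    have hcomm := he.commutator hS i α (-(m : ℤ) - 1) n (e.symm (Finsupp.single β q))
    rw [he.nprod_neg] at hcomm
    rw [eq_sub_of_add_eq hcomm.symm, map_sub, map_sub, map_smul, map_smul, he.current,
      rescale_latticeMode, ih, ih, rescale_single, rescale_single]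
    simp only [map_smul]
    rw [expCoeff_single_X_mul b ε hB]
    rw [show -(-(m : ℤ) - 1 + n) - 1 = -n - 1 + m + 1 by ring, smul_sub, smul_sub]
    congr 1
    simp only [smul_smul]
    congr 1
    ring

/-- A linear isomorphism `φ : V → V_L` respects all products as soon as it does so for the
generating states `h_i(-1) 𝟏` and `e^α`: the other fields are iterated residue products of the
fields of these states, in `V` by the Jacobi identity and in `V_L` by definition. -/
theorem map_nprod_of_generators (hS : S.IsVOA) (ε : Cocycle B) (φ : V ≃ₗ[ℂ] LatticeSpace ι L)
    (hcur : ∀ i n v, φ (S.nprod (h i) n v) = latticeMode b B i n (φ v))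
    (hexp : ∀ α n v, φ (S.nprod (groupVec φ α) n v) = expCoeff b B ε α (-n - 1) (φ v))
    (a : V) (n : ℤ) (v : V) :
    φ (S.nprod a n v) = (latticeVOA b B ε).nprod (φ a) n (φ v) := by
  have hlist (α : L) (l : List (ι × ℕ)) : ∀ (n : ℤ) (v : V),
      φ (S.nprod (φ.symm (Finsupp.single α (l.map MvPolynomial.X).prod)) n v) =
        mode (nestedProd (latticeCurrent b B) (expField b B ε α) l) n (φ v) := by
    induction l with
    | nil =>
      intro n v
      exact (hexp α n v).trans (by rw [← mode_expField]; rfl)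
    | cons im l ih =>
      intro n v
      have hstate : φ.symm (Finsupp.single α ((im :: l).map MvPolynomial.X).prod) =
          S.nprod (h im.1) (-(im.2 : ℤ) - 1)
            (φ.symm (Finsupp.single α (l.map MvPolynomial.X).prod)) := by
        rw [LinearEquiv.symm_apply_eq, hcur, φ.apply_symm_apply, latticeMode_neg_single,
          List.map_cons, List.prod_cons]
      rw [hstate, VertexData.nprod, hS.mode_nprod]
      exact resProd_intertwine φ
        (fun n v => (hcur im.1 n v).trans (by rw [mode_latticeCurrent])) ih _ n v
  suffices H : ∀ w, φ (S.nprod (φ.symm w) n v) = (latticeVOA b B ε).nprod w n (φ v) by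
    simpa using H (φ a)
  intro w
  induction w using Finsupp.induction_linear with
  | zero => simp [VertexData.zero_nprod]
  | add u w hu hw => rw [map_add, VertexData.add_nprod, VertexData.add_nprod, map_add, hu, hw]
  | single α q =>
    induction q using MvPolynomial.induction_on' with
    | monomial s a =>
      rw [← mul_one a, ← smul_eq_mul, ← MvPolynomial.smul_monomial, ← Finsupp.smul_single,
        map_smul, VertexData.smul_nprod, VertexData.smul_nprod, map_smul,
        latticeVOA_nprod_monomial, ← hlist, monomial_one_eq_prod_toList]
    | add p q hp hq =>
      rw [Finsupp.single_add, map_add, VertexData.add_nprod, VertexData.add_nprod, map_add, hp, hq]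

/-- An isomorphism of modules over the Heisenberg algebra sends the vacuum vector to a nonzero
multiple of `1 ⊗ e^0`, because the vacuum vector is a Heisenberg vacuum vector of weight `0`. -/
theorem exists_vac_eq_smul (hB : IsPosDefEven B) (hS : S.IsVOA) (hnt : Nontrivial V)
    (e : V ≃ₗ[ℂ] LatticeSpace ι L)
    (he : ∀ i n v, e (S.nprod (h i) n v) = latticeMode b B i n (e v)) :
    ∃ a : ℂˣ, e S.vac = (a : ℂ) • Finsupp.single 0 1 := by
  have hv (i : ι) (n : ℤ) (hn : 0 ≤ n) : latticeMode b B i n (e S.vac) = 0 := by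
    rw [← he, hS.nprod_vac_of_nonneg _ _ hn, map_zero]
  obtain ⟨a, ha⟩ := hB.exists_eq_single b 0 (e S.vac) (fun i n hn => hv i n hn.le)
    (fun i => by rw [hv i 0 le_rfl]; simp)
  have ha' : e S.vac = a • Finsupp.single 0 1 := by
    rw [ha, Finsupp.smul_single, MvPolynomial.smul_eq_C_mul, mul_one]
  refine ⟨Units.mk0 a fun h0 => ?_, ha'⟩
  have hvac : S.vac = 0 := by simpa [h0] using ha'
  obtain ⟨v, hv0⟩ := exists_ne (0 : V)
  apply hv0
  rw [← hS.nprod_vac v, hvac, VertexData.nprod_zero]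

end Isomorphism

end VOA

end

theorem mainTheorem7 {L : Type*} [AddCommGroup L] {ι : Type*} [Fintype ι]
    (b : Module.Basis ι ℤ L) (B : LinearMap.BilinForm ℤ L) (hB : VOA.IsPosDefEven B)
    (ε : VOA.Cocycle B)
    {V : Type*} [AddCommGroup V] [Module ℂ V] (S : VOA.VertexData V)
    (hS : S.IsVOA) (hsimple : S.IsSimple)
    (f : VOA.Fock ι →ₗ[ℂ] V) (hf : VOA.VertexData.IsHom (VOA.heisenberg (VOA.gram b B)) S f)
    (hinj : Function.Injective f)
    (hmod : VOA.VertexData.IsomorphicOver S (VOA.latticeVOA b B ε) f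
      VOA.heisenbergInclusion) :
    VOA.VertexData.Isomorphic S (VOA.latticeVOA b B ε) := by
  obtain ⟨e₀, he₀⟩ := hmod
  have hcur₀ (i : ι) (n : ℤ) (v : V) :
      e₀ (S.nprod (f (MvPolynomial.X (i, 0))) n v) = VOA.latticeMode b B i n (e₀ v) := by
    rw [he₀]
    exact VOA.latticeVOA_mode_X b ε i n _
  obtain ⟨a, ha⟩ := VOA.exists_vac_eq_smul hB hS hsimple.1 e₀ hcur₀
  let e : V ≃ₗ[ℂ] VOA.LatticeSpace ι L := e₀.trans (LinearEquiv.smulOfUnit a⁻¹)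
  have he_apply (v : V) : e v = ((a⁻¹ : ℂˣ) : ℂ) • e₀ v := rfl
  have he : VOA.IsRealization b B S (fun i => f (MvPolynomial.X (i, 0))) e :=
    { current := fun i n v => by rw [he_apply, he_apply, hcur₀, map_smul]
      vac := by rw [he_apply, ha, smul_smul, Units.inv_mul, one_smul] }
  -- A state of `M(1)` is determined by its `(-1)`-st product with the vacuum vector.
  have hef (u : VOA.Fock ι) : e (f u) = Finsupp.single 0 u := by
    rw [← hS.nprod_vac (f u), he_apply, he₀, ha, VOA.VertexData.nprod_smul, smul_smul,
      Units.inv_mul, one_smul]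
    exact VOA.latticeVOA_nprod_vac b ε u
  have hconf : e S.conf = Finsupp.single 0 (VOA.fockConf (VOA.gram b B)) := by
    rw [← hf.map_conf, hef]
    rfl
  have hc' := he.exists_structureConstant hB hS hconf
  choose c hc₀ using hc'
  have hc : VOA.IsStructureConstant b B S e c := fun α β n => by
    rw [← map_smul, ← hc₀, e.symm_apply_apply]
  obtain ⟨x, hx0, hx⟩ := hc.exists_rescaling he hB hS hsimple ε
  let φ : V ≃ₗ[ℂ] VOA.LatticeSpace ι L := e.trans (VOA.rescale x)
  have hφ0 (u : VOA.Fock ι) : VOA.rescale x (Finsupp.single 0 u) = Finsupp.single 0 u := by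
    rw [VOA.rescale_single, hx0, Units.val_one, one_smul]
  have hgroup (α : L) : VOA.groupVec φ α = ((x α)⁻¹ : ℂ) • VOA.groupVec e α := by
    rw [VOA.groupVec, LinearEquiv.symm_apply_eq, map_smul]
    change _ = _ • VOA.rescale x (e (e.symm _))
    rw [e.apply_symm_apply, VOA.rescale_single, smul_smul, inv_mul_cancel₀ (x α).ne_zero, one_smul]
  refine ⟨φ, fun a n v => ?_, ?_, ?_⟩
  · refine VOA.map_nprod_of_generators hS ε φ (h := fun i => f (MvPolynomial.X (i, 0)))
      (fun i n v => ?_) (fun α n v => ?_) a n v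
    · change VOA.rescale x (e _) = VOA.latticeMode b B i n (VOA.rescale x (e v))
      rw [he.current, VOA.rescale_latticeMode]
    · rw [hgroup, VOA.VertexData.smul_nprod, map_smul]
      change _ • VOA.rescale x (e _) = VOA.expCoeff b B ε α (-n - 1) (VOA.rescale x (e v))
      rw [he.rescale_nprod_groupVec hB hS hc ε hx, smul_smul, inv_mul_cancel₀ (x α).ne_zero,
        one_smul]
  · change VOA.rescale x (e S.vac) = Finsupp.single 0 1
    rw [he.vac, hφ0]
  · change VOA.rescale x (e S.conf) = Finsupp.single 0 (VOA.fockConf (VOA.gram b B))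
    rw [hconf, hφ0]
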